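/- **Theorem 1 (coverage with uniform directions).** Let $d\ge 2$. For each $\rho>0$ let $\eta_\rho=\{Y^{(1,\rho)},Y^{(2,\rho)},\dots\}$ be a homogeneous Poisson point process on $\mathbb{R}^{d-1}$ with intensity measure $\rho\,\lambda_{d-1}$, where $\lambda_{d-1}$ is Lebesgue measure, and let $S^{(1,\rho)},S^{(2,\rho)},\dots$ be independent random directions, independent of the points $Y^{(i,\rho)}$, each uniformly distributed on the upper hemisphere $\mathbb{S}^{d-1}_+=\{s\in\mathbb{R}^d:\|s\|=1,\ s_d\ge 0\}$, that is, with law $2\sigma_{d-1}$ restricted to $\mathbb{S}^{d-1}_+$, where $\sigma_{d-1}$ is the spherical measure normalised by $\sigma_{d-1}(\mathbb{S}^{d-1})=1$. Let $X^{(i,\rho)}=\{Y^{(i,\rho)}\times\{0\}+tS^{(i,\rho)}: t\ge 0\}\subset\mathbb{R}^d$. For $K\subset\mathbb{R}^d$ put $$\mathcal{X}_\rho(K)=\bigcup_{i\,:\,Y^{(i,\rho)}\in[0,1]^{d-1}}\bigl(X^{(i,\rho)}\oplus K\bigr),\qquad R_\rho(K)=\inf\{r\ge 0:\ [0,1]^d\subset\mathcal{X}_\rho(rK)\},$$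 where $\oplus$ is the Minkowski sum, $rK=\{rx:x\in K\}$ and $\inf\emptyset=\infty$. Let $B_d(o,1)$ be the closed unit ball of $\mathbb{R}^d$, let $\kappa_m$ be the volume of the $m$-dimensional unit ball, and let $$\phi_d(x)=\int_{[0,1]^{d-1}}\frac{1}{\|y\times\{0\}-x\|^{d-1}}\,\mathrm{d}y\in(0,\infty],\qquad x\in[0,1]^d .$$ Then, as $\rho\to\infty$, $$\frac{R_\rho(B_d(o,1))}{(\log\rho/\rho)^{1/(d-1)}}\ \overset{\mathbb{P}}{\longrightarrow}\ (c^*)^{1/(d-1)},\qquad c^*=\frac{d^2}{d-1}\cdot\frac{\kappa_d}{2\kappa_{d-1}}\cdot\frac{1}{\inf_{x\in[0,1]^d}\phi_d(x)} .$$ -/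

import Mathlib

open MeasureTheory ProbabilityTheory Filter Topology Set
open scoped ENNReal NNReal Pointwise

noncomputable section

namespace CylinderModel

/-- The unit cube `[0,1]^m` in `m`-dimensional Euclidean space. -/
def unitCube (m : ℕ) : Set (EuclideanSpace ℝ (Fin m)) :=
  {x | ∀ i, x i ∈ Set.Icc (0 : ℝ) 1}

/-- The point `y × {0}` of `ℝ^(n+1)`, for `y` in `ℝ^n`. -/
def base {n : ℕ} (y : EuclideanSpace ℝ (Fin n)) : EuclideanSpace ℝ (Fin (n + 1)) :=
  WithLp.toLp 2 (Fin.snoc (α := fun _ => ℝ) (fun i => y i) 0)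

/-- `κ m`, the volume of the `m`-dimensional Euclidean unit ball. -/
def kappa (m : ℕ) : ℝ≥0∞ :=
  volume (Metric.ball (0 : EuclideanSpace ℝ (Fin m)) 1)

/-- The function `φ_d` for `d = n + 1`: the integral over `y ∈ [0,1]^n` of `‖y × {0} - x‖^(-n)`,
with values in `[0, ∞]` (it is infinite on the base `[0,1]^n × {0}` of the cube). -/
def phi {n : ℕ} (x : EuclideanSpace ℝ (Fin (n + 1))) : ℝ≥0∞ :=
  ∫⁻ y in unitCube n, (ENNReal.ofReal (‖base y - x‖ ^ n))⁻¹

/-- The constant `c*` in dimension `d = n + 1`, so that `d - 1 = n`. -/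
def cStar (n : ℕ) : ℝ≥0∞ :=
  ((n : ℝ≥0∞) + 1) ^ 2 / n * (kappa (n + 1) / (2 * kappa n)) *
    (1 / ⨅ x ∈ unitCube (n + 1), phi x)

/-- The unit sphere of `ℝ^m`. -/
abbrev Sphere (m : ℕ) : Type :=
  Metric.sphere (0 : EuclideanSpace ℝ (Fin m)) 1

/-- The normalised spherical measure, of total mass one. -/
def sphereMeasure (m : ℕ) : Measure (Sphere m) :=
  ((volume : Measure (EuclideanSpace ℝ (Fin m))).toSphere Set.univ)⁻¹ •
    (volume : Measure (EuclideanSpace ℝ (Fin m))).toSphere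

/-- The closed upper hemisphere, where the last coordinate is nonnegative. -/
def upperHemisphere (n : ℕ) : Set (Sphere (n + 1)) :=
  {s | 0 ≤ s.1 (Fin.last n)}

/-- The uniform distribution on the upper hemisphere: twice the normalised spherical measure,
on the hemisphere. -/
def uniformDirection (n : ℕ) : Measure (Sphere (n + 1)) :=
  (2 : ℝ≥0∞) • (sphereMeasure (n + 1)).restrict (upperHemisphere n)

/-- The random measure `η` on `E` is a Poisson point process with intensity measure `μ`: the
number of points in a set `B` of finite `μ`-measure is Poisson distributed with mean `μ B`, and
the numbers of points in finitely many pairwise disjoint sets are independent. -/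
structure IsPoissonProcess {Ω E : Type*} [MeasurableSpace Ω] [MeasurableSpace E]
    (η : Ω → Measure E) (μ : Measure E) (P : Measure Ω) : Prop where
  measurable : Measurable η
  law : ∀ B : Set E, MeasurableSet B → μ B < ∞ →
    P.map (fun ω => η ω B) = (poissonMeasure (μ B).toNNReal).map (fun k : ℕ => (k : ℝ≥0∞))
  indep : ∀ (k : ℕ) (B : Fin k → Set E), (∀ j, MeasurableSet (B j)) →
    Pairwise (fun i j => Disjoint (B i) (B j)) → iIndepFun (fun j ω => η ω (B j)) P

/-- The starting points `Y i` are the points of a homogeneous Poisson process of intensity `ρ` on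
`ℝ^n`, and the directions `S i` are independent, uniform on the upper hemisphere of `ℝ^(n+1)`, and
independent of the starting points. -/
structure IsLineModel {Ω : Type*} [MeasurableSpace Ω] {n : ℕ} (ρ : ℝ)
    (Y : ℕ → Ω → EuclideanSpace ℝ (Fin n)) (S : ℕ → Ω → Sphere (n + 1))
    (P : Measure Ω) : Prop where
  measurable_start : ∀ i, Measurable (Y i)
  measurable_direction : ∀ i, Measurable (S i)
  poisson : IsPoissonProcess (fun ω => Measure.sum fun i => Measure.dirac (Y i ω))
    (ENNReal.ofReal ρ • volume) P
  direction_law : ∀ i, P.map (S i) = uniformDirection n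
  direction_indep : iIndepFun S P
  start_indep_direction : IndepFun (fun ω i => Y i ω) (fun ω i => S i ω) P

/-- The trajectory `{y × {0} + t s : t ≥ 0}`. -/
def trajectory {n : ℕ} (y : EuclideanSpace ℝ (Fin n)) (s : Sphere (n + 1)) :
    Set (EuclideanSpace ℝ (Fin (n + 1))) :=
  {z | ∃ t : ℝ, 0 ≤ t ∧ z = base y + t • s.1}

/-- The cylinder set: the union, over the points `y i` that lie in `[0,1]^n`, of the Minkowski
sums of the trajectories with `K`. -/
def cylinderSet {n : ℕ} (y : ℕ → EuclideanSpace ℝ (Fin n)) (s : ℕ → Sphere (n + 1))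
    (K : Set (EuclideanSpace ℝ (Fin (n + 1)))) : Set (EuclideanSpace ℝ (Fin (n + 1))) :=
  ⋃ i ∈ {i | y i ∈ unitCube n}, trajectory (y i) (s i) + K

/-- The coverage radius: the infimum of the `r ≥ 0` such that the cylinder set built with `r K`
contains the unit cube. It is infinite if there is no such `r`. -/
def coverageRadius {n : ℕ} (y : ℕ → EuclideanSpace ℝ (Fin n)) (s : ℕ → Sphere (n + 1))
    (K : Set (EuclideanSpace ℝ (Fin (n + 1)))) : ℝ≥0∞ :=
  ⨅ (r : ℝ≥0) (_ : unitCube (n + 1) ⊆ cylinderSet y s ((r : ℝ) • K)), (r : ℝ≥0∞)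

end CylinderModel

end

/-! Write n = d - 1. By the void probability formula for an independently marked Poisson process
(`measure_forall_notMem_eq_exp`), the ball of radius r about x is missed by all trajectories with
probability exp(-ρ Λ(x, r)), where Λ is `hitIntensity`. A ball of small radius r at distance D is
hit by a uniform ray with probability about K (r / D)^n, K = `capConst n`, so away from the base
Λ(x, r) is about K r^n φ(x). At r = b (log ρ / ρ)^(1/n) the miss probability is therefore about
ρ^(-K φ(x) b^n). Up to logarithms there are r^(-(n+1)), that is ρ^((n+1)/n), separate locations in
the cube, and they are hardest to cover where φ is smallest. Coverage thus switches on at K (inf φ)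
b^n = (n+1)/n, which is b^n = c*.

Upper bound (`tendsto_measure_lt_coverageRadius`): a union bound over a grid of mesh of order
ρ^(-1/n). It needs a lower bound on Λ uniform in the whole cube (`exists_forall_le_hitIntensity`).
Near the base the comparison with φ breaks down, but there the logarithmic divergence of the
integral of ‖y‖^(-n) makes Λ(x, r) / r^n as large as desired.

Lower bound (`tendsto_measure_coverageRadius_lt`): a second moment argument for the number of missed
points of a grid of mesh of order ρ^(-e), with e slightly below 1/n, in a small box near an
almost-minimiser of φ. The miss events of x and x' are correlated only through trajectories that hit
both balls, whose intensity is O(r^n (r / ‖x - x'‖)^n) (`exists_hitPairs_inter_le`). This is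
negligible at that mesh. -/

namespace CylinderModel

/-! ### The measure of a spherical cap -/

/-- The directions whose ray from the origin meets the closed ball of radius `r` about `v`. -/
def hitSet {m : ℕ} (v : EuclideanSpace ℝ (Fin m)) (r : ℝ) : Set (Sphere m) :=
  {s | ∃ t : ℝ, 0 ≤ t ∧ ‖t • s.1 - v‖ ≤ r}

lemma norm_smul_sub_sq {E : Type*} [NormedAddCommGroup E] [InnerProductSpace ℝ E]
    (s v : E) (hs : ‖s‖ = 1) (t : ℝ) :
    ‖t • s - v‖ ^ 2 = t ^ 2 - 2 * t * inner ℝ s v + ‖v‖ ^ 2 := by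
  rw [norm_sub_sq_real, norm_smul, hs, inner_smul_left]
  simp
  ring

/-- The point of the ray nearest to v has parameter max 0 ⟨s, v⟩. This replaces the existential by a
closed condition in s, from which measurability follows. -/
lemma exists_norm_smul_sub_le_iff {E : Type*} [NormedAddCommGroup E] [InnerProductSpace ℝ E]
    (s v : E) (hs : ‖s‖ = 1) (r : ℝ) :
    (∃ t : ℝ, 0 ≤ t ∧ ‖t • s - v‖ ≤ r) ↔ ‖max 0 (inner ℝ s v) • s - v‖ ≤ r := by
  refine ⟨?_, fun h => ⟨_, le_max_left _ _, h⟩⟩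
  rintro ⟨t, ht, h⟩
  refine le_trans ?_ h
  refine le_of_sq_le_sq ?_ (norm_nonneg _)
  rw [norm_smul_sub_sq s v hs, norm_smul_sub_sq s v hs]
  rcases le_total 0 (inner ℝ s v) with h0 | h0
  · rw [max_eq_right h0]
    nlinarith [sq_nonneg (t - inner ℝ s v)]
  · rw [max_eq_left h0]
    nlinarith [sq_nonneg t, mul_nonneg ht (neg_nonneg.2 h0)]

lemma measurableSet_hitSet {m : ℕ} (v : EuclideanSpace ℝ (Fin m)) (r : ℝ) :
    MeasurableSet (hitSet v r) := by
  have : hitSet v r = {s : Sphere m | ‖max 0 (inner ℝ s.1 v) • s.1 - v‖ ≤ r} := by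
    ext s
    exact exists_norm_smul_sub_le_iff s.1 v (by simp) r
  rw [this]
  refine IsClosed.measurableSet (isClosed_le ?_ continuous_const)
  fun_prop

/-- Cylindrical coordinates about the axis e, obtained by completing e to an orthonormal basis. They
reduce the cone over a spherical cap to a round cone in ℝ × ℝ^n. -/
lemma exists_measurePreserving_split {n : ℕ} (e : EuclideanSpace ℝ (Fin (n + 1)))
    (he : ‖e‖ = 1) :
    ∃ f : EuclideanSpace ℝ (Fin (n + 1)) → ℝ × EuclideanSpace ℝ (Fin n),
      MeasurePreserving f volume (volume.prod volume) ∧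
      ∀ z, (f z).1 = inner ℝ e z ∧ ‖z‖ ^ 2 = (f z).1 ^ 2 + ‖(f z).2‖ ^ 2 := by
  obtain ⟨b, hb⟩ := Orthonormal.exists_orthonormalBasis_extension_of_card_eq (𝕜 := ℝ)
    (E := EuclideanSpace ℝ (Fin (n + 1))) (ι := Fin (n + 1)) (by simp) (v := fun _ => e)
    (s := {0}) (by
      rw [orthonormal_iff_ite]
      intro i j
      have : i = j := Subsingleton.elim _ _
      subst this
      simp [he])
  have hb0 : b 0 = e := hb 0 (by simp)
  refine ⟨fun z => ((b.repr z).ofLp 0, WithLp.toLp 2 (fun i => (b.repr z).ofLp (Fin.succ i))),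
    ?_, ?_⟩
  · have h1 := b.measurePreserving_repr
    have h2 := PiLp.volume_preserving_ofLp (Fin (n + 1))
    have h3 := volume_preserving_piFinSuccAbove (fun _ : Fin (n + 1) => ℝ) 0
    have h4 : MeasurePreserving (Prod.map id (WithLp.toLp 2) :
        ℝ × (Fin n → ℝ) → ℝ × EuclideanSpace ℝ (Fin n))
        (volume.prod volume) (volume.prod volume) :=
      (MeasurePreserving.id _).prod (PiLp.volume_preserving_toLp (Fin n))
    exact h4.comp (h3.comp (h2.comp h1))
  · intro z
    constructor
    · simp [b.repr_apply_apply, hb0]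
    · rw [← b.repr.norm_map z, EuclideanSpace.norm_sq_eq, EuclideanSpace.norm_sq_eq,
        Fin.sum_univ_succ]
      simp

lemma measurableSet_truncated_cone {n : ℕ} (h τ : ℝ) :
    MeasurableSet {p : ℝ × EuclideanSpace ℝ (Fin n) | 0 < p.1 ∧ p.1 < h ∧ ‖p.2‖ ≤ τ * p.1} :=
  (measurableSet_lt measurable_const measurable_fst).inter
    ((measurableSet_lt measurable_fst measurable_const).inter
    (measurableSet_le measurable_snd.norm (measurable_fst.const_mul τ)))

lemma volume_truncated_cone {n : ℕ} (h τ : ℝ) (hh : 0 ≤ h) (hτ : 0 ≤ τ) :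
    (volume.prod volume) {p : ℝ × EuclideanSpace ℝ (Fin n) |
      0 < p.1 ∧ p.1 < h ∧ ‖p.2‖ ≤ τ * p.1} =
      ENNReal.ofReal (τ ^ n * h ^ (n + 1) / (n + 1)) * kappa n := by
  rw [Measure.prod_apply (measurableSet_truncated_cone h τ)]
  have hsec : ∀ a : ℝ, volume (Prod.mk a ⁻¹' {p : ℝ × EuclideanSpace ℝ (Fin n) |
      0 < p.1 ∧ p.1 < h ∧ ‖p.2‖ ≤ τ * p.1}) =
      (Ioo 0 h).indicator (fun a => ENNReal.ofReal (τ ^ n * a ^ n) * kappa n) a := by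
    intro a
    by_cases ha : a ∈ Ioo 0 h
    · rw [indicator_of_mem ha]
      have : (Prod.mk a ⁻¹' {p : ℝ × EuclideanSpace ℝ (Fin n) |
          0 < p.1 ∧ p.1 < h ∧ ‖p.2‖ ≤ τ * p.1}) = Metric.closedBall 0 (τ * a) := by
        ext w
        simp [ha.1, ha.2]
      rw [this, Measure.addHaar_closedBall _ _ (mul_nonneg hτ ha.1.le)]
      simp [kappa, mul_pow]
    · rw [indicator_of_notMem ha]
      have : (Prod.mk a ⁻¹' {p : ℝ × EuclideanSpace ℝ (Fin n) |
          0 < p.1 ∧ p.1 < h ∧ ‖p.2‖ ≤ τ * p.1}) = ∅ := by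
        ext w
        simp only [mem_preimage, mem_ofPred_eq, mem_empty_iff_false, iff_false]
        exact fun hw => ha ⟨hw.1, hw.2.1⟩
      simp [this]
  simp_rw [hsec]
  rw [lintegral_indicator measurableSet_Ioo, lintegral_mul_const _ (by fun_prop)]
  congr 1
  rw [Measure.restrict_congr_set Ioo_ae_eq_Ioc,
    ← ofReal_integral_eq_lintegral_ofReal (f := fun a : ℝ => τ ^ n * a ^ n)
      (Continuous.intervalIntegrable (by fun_prop) 0 h).1,
    ← intervalIntegral.integral_of_le hh]
  · congr 1
    rw [intervalIntegral.integral_const_mul, integral_pow]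
    simp
    ring
  · filter_upwards [ae_restrict_mem measurableSet_Ioc] with y hy
    have := hy.1.le
    positivity

lemma volume_preimage_truncated_cone {n : ℕ} {f : EuclideanSpace ℝ (Fin (n + 1)) →
      ℝ × EuclideanSpace ℝ (Fin n)} (hf : MeasurePreserving f volume (volume.prod volume))
    (h τ : ℝ) (hh : 0 ≤ h) (hτ : 0 ≤ τ) :
    volume {z | 0 < (f z).1 ∧ (f z).1 < h ∧ ‖(f z).2‖ ≤ τ * (f z).1} =
      ENNReal.ofReal (τ ^ n * h ^ (n + 1) / (n + 1)) * kappa n := by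
  rw [← volume_truncated_cone h τ hh hτ]
  exact hf.measure_preimage (measurableSet_truncated_cone h τ).nullMeasurableSet

/-- The hitting directions form a cap of half-angle α with sin α = r / ‖v‖. `toSphere` is n + 1
times the volume of the cone over the cap, and that cone lies in the straight cone of height 1 and
slope tan α. -/
lemma toSphere_hitSet_le {n : ℕ} (v : EuclideanSpace ℝ (Fin (n + 1))) (r : ℝ) (hr : 0 ≤ r)
    (hv : r < ‖v‖) :
    (volume : Measure (EuclideanSpace ℝ (Fin (n + 1)))).toSphere (hitSet v r) ≤
      ENNReal.ofReal ((r / √(‖v‖ ^ 2 - r ^ 2)) ^ n) * kappa n := by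
  have hD : 0 < ‖v‖ := hr.trans_lt hv
  obtain ⟨f, hf, hfz⟩ := exists_measurePreserving_split (‖v‖⁻¹ • v)
    (by rw [norm_smul, norm_inv, norm_norm, inv_mul_cancel₀ hD.ne'])
  have hq : 0 < ‖v‖ ^ 2 - r ^ 2 := by nlinarith
  have hsq : 0 < √(‖v‖ ^ 2 - r ^ 2) := Real.sqrt_pos.2 hq
  rw [Measure.toSphere_apply' _ (measurableSet_hitSet v r)]
  have hsub : Ioo (0 : ℝ) 1 • ((fun s : Sphere (n + 1) => s.1) '' hitSet v r) ⊆
      {z | 0 < (f z).1 ∧ (f z).1 < 1 ∧ ‖(f z).2‖ ≤ r / √(‖v‖ ^ 2 - r ^ 2) * (f z).1} := by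
    rintro _ ⟨t, ⟨ht0, ht1⟩, _, ⟨s, ⟨u, hu, hus⟩, rfl⟩, rfl⟩
    have hs : ‖s.1‖ = 1 := by simp
    obtain ⟨h1, h2⟩ := hfz (t • s.1)
    have h3 := norm_smul_sub_sq s.1 v hs u
    have h4 : ‖u • s.1 - v‖ ^ 2 ≤ r ^ 2 := by gcongr
    rw [inner_smul_left, inner_smul_right, real_inner_comm] at h1
    simp only [map_inv₀, conj_trivial] at h1
    rw [norm_smul, hs, mul_one, Real.norm_eq_abs, abs_of_pos ht0] at h2
    set i := inner ℝ s.1 v with hi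
    have hi1 : i ≤ ‖v‖ := by
      have := real_inner_le_norm s.1 v
      rwa [hs, one_mul] at this
    -- If ⟨s, v⟩ ≤ 0, the origin is the nearest point of the ray, at distance ‖v‖ > r.
    have hipos : 0 < i := by
      by_contra hcon
      push Not at hcon
      nlinarith [mul_nonneg hu (neg_nonneg.2 hcon), sq_nonneg u]
    have hi2 : ‖v‖ ^ 2 - r ^ 2 ≤ i ^ 2 := by nlinarith [sq_nonneg (u - i)]
    have ha : (f (t • s.1)).1 = t * i / ‖v‖ := by rw [h1]; field_simp
    have hapos : 0 < t * i / ‖v‖ := by positivity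
    refine ⟨by dsimp only; rw [ha]; exact hapos, ?_, ?_⟩
    · dsimp only
      rw [ha, div_lt_one hD]
      nlinarith
    · dsimp only
      rw [ha] at h2 ⊢
      refine le_of_sq_le_sq ?_ (by positivity)
      have h5 : ‖(f (t • s.1)).2‖ ^ 2 = t ^ 2 - (t * i / ‖v‖) ^ 2 := by linarith
      rw [h5, mul_pow, div_pow, div_pow, Real.sq_sqrt hq.le]
      have h6 : r ^ 2 / (‖v‖ ^ 2 - r ^ 2) * ((t * i) ^ 2 / ‖v‖ ^ 2) - (t ^ 2 - (t * i) ^ 2 / ‖v‖ ^ 2)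
        = t ^ 2 * (i ^ 2 - (‖v‖ ^ 2 - r ^ 2)) / (‖v‖ ^ 2 - r ^ 2) := by
        field_simp
        ring
      have h7 : 0 ≤ t ^ 2 * (i ^ 2 - (‖v‖ ^ 2 - r ^ 2)) / (‖v‖ ^ 2 - r ^ 2) :=
        div_nonneg (mul_nonneg (sq_nonneg _) (by linarith)) hq.le
      linarith
  refine (mul_le_mul_right (measure_mono hsub) _).trans ?_
  rw [volume_preimage_truncated_cone hf 1 _ zero_le_one (by positivity), ← mul_assoc]
  refine le_of_eq ?_
  congr 1
  rw [finrank_euclideanSpace_fin, ← ENNReal.ofReal_natCast, ← ENNReal.ofReal_mul (by positivity)]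
  congr 1
  push_cast
  field_simp
  simp

/-- The straight cone with slope tan α and height cos α fits inside the unit ball, hence in the cone
over the cap. Its volume gives tan^n α · cos^(n+1) α = sin^n α · cos α. -/
lemma le_toSphere_hitSet {n : ℕ} (v : EuclideanSpace ℝ (Fin (n + 1))) (r : ℝ) (hr : 0 ≤ r)
    (hv : r < ‖v‖) :
    ENNReal.ofReal ((r / ‖v‖) ^ n * (√(‖v‖ ^ 2 - r ^ 2) / ‖v‖)) * kappa n ≤
      (volume : Measure (EuclideanSpace ℝ (Fin (n + 1)))).toSphere (hitSet v r) := by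
  have hD : 0 < ‖v‖ := hr.trans_lt hv
  obtain ⟨f, hf, hfz⟩ := exists_measurePreserving_split (‖v‖⁻¹ • v)
    (by rw [norm_smul, norm_inv, norm_norm, inv_mul_cancel₀ hD.ne'])
  have hq : 0 < ‖v‖ ^ 2 - r ^ 2 := by nlinarith
  have hsq : 0 < √(‖v‖ ^ 2 - r ^ 2) := Real.sqrt_pos.2 hq
  rw [Measure.toSphere_apply' _ (measurableSet_hitSet v r)]
  have hsub : {z | 0 < (f z).1 ∧ (f z).1 < √(‖v‖ ^ 2 - r ^ 2) / ‖v‖ ∧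
      ‖(f z).2‖ ≤ r / √(‖v‖ ^ 2 - r ^ 2) * (f z).1} ⊆
      Ioo (0 : ℝ) 1 • ((fun s : Sphere (n + 1) => s.1) '' hitSet v r) := by
    rintro z ⟨h1, h2, h3⟩
    obtain ⟨h4, h5⟩ := hfz z
    set a := (f z).1 with ha
    have hw : ‖(f z).2‖ ^ 2 ≤ r ^ 2 / (‖v‖ ^ 2 - r ^ 2) * a ^ 2 := by
      calc ‖(f z).2‖ ^ 2 ≤ (r / √(‖v‖ ^ 2 - r ^ 2) * a) ^ 2 := by gcongr
        _ = _ := by rw [mul_pow, div_pow, Real.sq_sqrt hq.le]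
    have hz : ‖z‖ ^ 2 * (‖v‖ ^ 2 - r ^ 2) ≤ a ^ 2 * ‖v‖ ^ 2 := by
      have : ‖z‖ ^ 2 ≤ a ^ 2 * ‖v‖ ^ 2 / (‖v‖ ^ 2 - r ^ 2) := by
        calc ‖z‖ ^ 2 ≤ a ^ 2 + r ^ 2 / (‖v‖ ^ 2 - r ^ 2) * a ^ 2 := by linarith
          _ = _ := by field_simp; ring
      rwa [le_div_iff₀ hq] at this
    have hz0 : 0 < ‖z‖ := by
      rw [norm_pos_iff]
      rintro rfl
      simp at h4
      linarith
    have ha2 : a ^ 2 * ‖v‖ ^ 2 < ‖v‖ ^ 2 - r ^ 2 := by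
      rw [lt_div_iff₀ hD] at h2
      calc a ^ 2 * ‖v‖ ^ 2 = (a * ‖v‖) ^ 2 := by ring
        _ < √(‖v‖ ^ 2 - r ^ 2) ^ 2 := by gcongr
        _ = _ := Real.sq_sqrt hq.le
    have hz1 : ‖z‖ < 1 := by
      have : ‖z‖ ^ 2 < 1 := by
        by_contra hcon
        push Not at hcon
        nlinarith
      nlinarith
    have hn : ‖‖z‖⁻¹ • z‖ = 1 := by rw [norm_smul, norm_inv, norm_norm, inv_mul_cancel₀ hz0.ne']
    refine ⟨‖z‖, ⟨hz0, hz1⟩, ‖z‖⁻¹ • z, ⟨⟨‖z‖⁻¹ • z, by simpa using hn⟩, ?_, rfl⟩, ?_⟩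
    · rw [inner_smul_left, real_inner_comm] at h4
      simp only [map_inv₀, conj_trivial] at h4
      have hin : inner ℝ (‖z‖⁻¹ • z) v = a * ‖v‖ / ‖z‖ := by
        rw [inner_smul_left, h4]
        simp only [map_inv₀, conj_trivial]
        field_simp
      -- The parameter is ⟨z / ‖z‖, v⟩, the foot of the perpendicular from v to the ray.
      refine ⟨a * ‖v‖ / ‖z‖, by positivity, ?_⟩
      refine le_of_sq_le_sq ?_ hr
      dsimp only
      rw [norm_smul_sub_sq _ v hn, hin]
      have : ‖v‖ ^ 2 - r ^ 2 ≤ a ^ 2 * ‖v‖ ^ 2 / ‖z‖ ^ 2 := by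
        rw [le_div_iff₀ (by positivity)]
        linarith
      have h8 : (a * ‖v‖ / ‖z‖) ^ 2 = a ^ 2 * ‖v‖ ^ 2 / ‖z‖ ^ 2 := by rw [div_pow, mul_pow]
      nlinarith
    · simp only [smul_smul]
      rw [mul_inv_cancel₀ hz0.ne', one_smul]
  refine le_trans ?_ (mul_le_mul_right (measure_mono hsub) _)
  rw [volume_preimage_truncated_cone hf _ _ (by positivity) (by positivity), ← mul_assoc]
  refine le_of_eq ?_
  congr 1
  rw [finrank_euclideanSpace_fin, ← ENNReal.ofReal_natCast, ← ENNReal.ofReal_mul (by positivity)]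
  congr 1
  push_cast
  rw [div_pow, div_pow, div_pow]
  field_simp
  ring

/-! ### The probability that a uniform ray hits a ball -/

lemma kappa_pos (m : ℕ) : 0 < kappa m := Metric.measure_ball_pos _ _ one_pos

lemma kappa_lt_top (m : ℕ) : kappa m < ∞ := measure_ball_lt_top

/-- The constant `2 κ_n / ((n + 1) κ_{n+1})`: up to a factor tending to one, a ball of radius `r`
at distance `D` is hit by a uniform ray with probability `capConst n * (r / D) ^ n`. -/
noncomputable def capConst (n : ℕ) : ℝ :=
  2 * (kappa n).toReal / ((n + 1) * (kappa (n + 1)).toReal)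

lemma kappa_toReal_pos (m : ℕ) : 0 < (kappa m).toReal :=
  ENNReal.toReal_pos (kappa_pos m).ne' (kappa_lt_top m).ne

lemma capConst_pos (n : ℕ) : 0 < capConst n := by
  have := kappa_toReal_pos n
  have := kappa_toReal_pos (n + 1)
  unfold capConst
  positivity

/-- The origin of `capConst`: the factor 2 comes from the hemisphere, and the sphere has total mass
(n + 1) κ_{n+1}. -/
lemma two_mul_inv_toSphere_univ (n : ℕ) (x : ℝ) :
    2 * (((volume : Measure (EuclideanSpace ℝ (Fin (n + 1)))).toSphere univ)⁻¹ *
      (ENNReal.ofReal x * kappa n)) = ENNReal.ofReal (capConst n * x) := by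
  have h1 := kappa_toReal_pos n
  have h2 := kappa_toReal_pos (n + 1)
  rw [Measure.toSphere_apply_univ, finrank_euclideanSpace_fin,
    show volume (Metric.ball (0 : EuclideanSpace ℝ (Fin (n + 1))) 1) = kappa (n + 1) from rfl,
    ← ENNReal.ofReal_toReal (kappa_lt_top n).ne, ← ENNReal.ofReal_toReal (kappa_lt_top (n + 1)).ne,
    ← ENNReal.ofReal_natCast, ← ENNReal.ofReal_mul (by positivity),
    ← ENNReal.ofReal_inv_of_pos (by positivity), ← ENNReal.ofReal_mul' h1.le,
    ← ENNReal.ofReal_mul (by positivity), show (2 : ℝ≥0∞) = ENNReal.ofReal 2 by simp,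
    ← ENNReal.ofReal_mul (by positivity)]
  congr 1
  unfold capConst
  push_cast
  field_simp

lemma uniformDirection_hitSet_le {n : ℕ} (v : EuclideanSpace ℝ (Fin (n + 1))) (r : ℝ)
    (hr : 0 ≤ r) (hv : r < ‖v‖) :
    uniformDirection n (hitSet v r) ≤
      ENNReal.ofReal (capConst n * (r / √(‖v‖ ^ 2 - r ^ 2)) ^ n) := by
  rw [← two_mul_inv_toSphere_univ]
  simp only [uniformDirection, sphereMeasure, Measure.smul_apply, smul_eq_mul]
  rw [Measure.restrict_apply (measurableSet_hitSet v r), Measure.smul_apply, smul_eq_mul]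
  gcongr
  exact (measure_mono inter_subset_left).trans (toSphere_hitSet_le v r hr hv)

/-- A ball in the closed upper half-space is not reached by descending rays. The hypothesis r < ‖v‖
excludes t = 0, which would impose nothing on the direction. -/
lemma hitSet_subset_upperHemisphere {n : ℕ} (v : EuclideanSpace ℝ (Fin (n + 1))) (r : ℝ)
    (hv : r < ‖v‖) (hl : r ≤ v (Fin.last n)) : hitSet v r ⊆ upperHemisphere n := by
  rintro s ⟨t, ht, h⟩
  have h1 : |(t • s.1 - v) (Fin.last n)| ≤ r := by
    refine le_trans ?_ h
    simpa using PiLp.norm_apply_le (t • s.1 - v) (Fin.last n)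
  simp only [PiLp.sub_apply, PiLp.smul_apply, smul_eq_mul] at h1
  have h2 := (abs_le.1 h1).1
  rcases ht.eq_or_lt with rfl | ht
  · simp at h
    linarith
  · change 0 ≤ s.1 (Fin.last n)
    by_contra hcon
    push Not at hcon
    nlinarith

lemma le_uniformDirection_hitSet {n : ℕ} (v : EuclideanSpace ℝ (Fin (n + 1))) (r : ℝ)
    (hr : 0 ≤ r) (hv : r < ‖v‖) (hl : r ≤ v (Fin.last n)) :
    ENNReal.ofReal (capConst n * ((r / ‖v‖) ^ n * (√(‖v‖ ^ 2 - r ^ 2) / ‖v‖))) ≤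
      uniformDirection n (hitSet v r) := by
  rw [← two_mul_inv_toSphere_univ]
  simp only [uniformDirection, sphereMeasure, Measure.smul_apply, smul_eq_mul]
  rw [Measure.restrict_apply (measurableSet_hitSet v r), Measure.smul_apply, smul_eq_mul,
    inter_eq_left.2 (hitSet_subset_upperHemisphere v r hv hl)]
  gcongr
  exact le_toSphere_hitSet v r hr hv

instance (n : ℕ) : IsFiniteMeasure (uniformDirection n) := by
  refine ⟨?_⟩
  simp only [uniformDirection, sphereMeasure, Measure.smul_apply, smul_eq_mul]
  rw [Measure.restrict_apply .univ, Measure.smul_apply, smul_eq_mul]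
  refine ENNReal.mul_lt_top (by simp) (ENNReal.mul_lt_top ?_ (measure_lt_top _ _))
  rw [ENNReal.inv_lt_top]
  exact Measure.measure_univ_pos.2 (Measure.toSphere_ne_zero _)

/-! ### The intensity of rays hitting a ball -/

lemma base_apply_last {n : ℕ} (y : EuclideanSpace ℝ (Fin n)) : base y (Fin.last n) = 0 := by
  simp [base]

lemma base_apply_castSucc {n : ℕ} (y : EuclideanSpace ℝ (Fin n)) (i : Fin n) :
    base y i.castSucc = y i := by
  simp [base]

lemma norm_base_sub_base {n : ℕ} (y z : EuclideanSpace ℝ (Fin n)) :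
    ‖base y - base z‖ = ‖y - z‖ := by
  rw [EuclideanSpace.norm_eq, EuclideanSpace.norm_eq, Fin.sum_univ_castSucc]
  simp [base_apply_last, base_apply_castSucc]

lemma continuous_base {n : ℕ} : Continuous (base (n := n)) := by
  refine (Isometry.of_dist_eq fun y z => ?_).continuous
  rw [dist_eq_norm, dist_eq_norm, norm_base_sub_base]

lemma measurableSet_unitCube (n : ℕ) : MeasurableSet (unitCube n) := by
  have : unitCube n = ⋂ i, {x | x i ∈ Icc (0 : ℝ) 1} := by
    ext x
    simp [unitCube]
  rw [this]
  refine MeasurableSet.iInter fun i => measurableSet_Icc.preimage (f := fun x : EuclideanSpace ℝ (Fin n) => x i) (by fun_prop)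

lemma volume_toLp_pi {n : ℕ} (s : Fin n → Set ℝ) (hs : ∀ i, MeasurableSet (s i)) :
    volume {x : EuclideanSpace ℝ (Fin n) | ∀ i, x i ∈ s i} = ∏ i, volume (s i) := by
  rw [← volume_pi_pi s, ← (PiLp.volume_preserving_ofLp (Fin n)).measure_preimage
    (MeasurableSet.univ_pi hs).nullMeasurableSet]
  congr 1
  ext x
  simp

lemma volume_unitCube (n : ℕ) : volume (unitCube n) = 1 := by
  rw [unitCube, volume_toLp_pi _ fun _ => measurableSet_Icc]
  simp

/-- The pairs of a starting point in the unit cube and a direction whose trajectory meets the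
closed ball of radius `r` about `x`. -/
def hitPairs {n : ℕ} (x : EuclideanSpace ℝ (Fin (n + 1))) (r : ℝ) :
    Set (EuclideanSpace ℝ (Fin n) × Sphere (n + 1)) :=
  {p | p.1 ∈ unitCube n ∧ p.2 ∈ hitSet (x - base p.1) r}

lemma measurableSet_hitPairs {n : ℕ} (x : EuclideanSpace ℝ (Fin (n + 1))) (r : ℝ) :
    MeasurableSet (hitPairs x r) := by
  have : hitPairs x r = Prod.fst ⁻¹' unitCube n ∩
      {p | ‖max 0 (inner ℝ p.2.1 (x - base p.1)) • p.2.1 - (x - base p.1)‖ ≤ r} := by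
    ext p
    exact and_congr_right fun _ => exists_norm_smul_sub_le_iff p.2.1 (x - base p.1) (by simp) r
  rw [this]
  refine (measurable_fst (measurableSet_unitCube n)).inter
    (IsClosed.measurableSet (isClosed_le ?_ continuous_const))
  have := continuous_base (n := n)
  fun_prop

/-- The expected number of trajectories meeting a ball, for intensity one. -/
noncomputable def hitIntensity {n : ℕ} (x : EuclideanSpace ℝ (Fin (n + 1))) (r : ℝ) : ℝ≥0∞ :=
  (volume.prod (uniformDirection n)) (hitPairs x r)

lemma hitIntensity_eq {n : ℕ} (x : EuclideanSpace ℝ (Fin (n + 1))) (r : ℝ) :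
    hitIntensity x r = ∫⁻ y in unitCube n, uniformDirection n (hitSet (x - base y) r) := by
  rw [hitIntensity, Measure.prod_apply (measurableSet_hitPairs x r),
    ← lintegral_indicator (measurableSet_unitCube n)]
  congr 1 with y
  by_cases hy : y ∈ unitCube n
  · rw [indicator_of_mem hy]
    congr 1
    ext s
    simp [hitPairs, hy]
  · rw [indicator_of_notMem hy]
    have : Prod.mk y ⁻¹' hitPairs x r = ∅ := by
      ext s
      simp [hitPairs, hy]
    simp [this]

lemma le_norm_sub_base {n : ℕ} (x : EuclideanSpace ℝ (Fin (n + 1)))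
    (y : EuclideanSpace ℝ (Fin n)) : x (Fin.last n) ≤ ‖x - base y‖ := by
  have := PiLp.norm_apply_le (x - base y) (Fin.last n)
  simp only [PiLp.sub_apply, base_apply_last, sub_zero, Real.norm_eq_abs] at this
  exact (le_abs_self _).trans this

/-! ### Comparison of the intensity with `phi` -/

lemma norm_le_sqrt_of_coord {m : ℕ} (x : EuclideanSpace ℝ (Fin m)) (c : ℝ) (hc : 0 ≤ c)
    (h : ∀ i, |x i| ≤ c) : ‖x‖ ≤ √m * c := by
  rw [EuclideanSpace.norm_eq]
  refine Real.sqrt_le_iff.2 ⟨by positivity, ?_⟩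
  calc ∑ i, ‖x i‖ ^ 2 ≤ ∑ _i : Fin m, c ^ 2 := by
        refine Finset.sum_le_sum fun i _ => ?_
        rw [Real.norm_eq_abs]
        gcongr
        exact h i
    _ = _ := by
        rw [mul_pow, Real.sq_sqrt (by positivity)]
        simp

lemma norm_sub_base_le {n : ℕ} {x : EuclideanSpace ℝ (Fin (n + 1))} (hx : x ∈ unitCube (n + 1))
    {y : EuclideanSpace ℝ (Fin n)} (hy : y ∈ unitCube n) : ‖x - base y‖ ≤ √(n + 1) := by
  have := norm_le_sqrt_of_coord (x - base y) 1 zero_le_one ?_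
  · simpa using this
  · intro i
    have h1 := hx i
    refine Fin.lastCases ?_ (fun j => ?_) i
    · have h1 := hx (Fin.last n)
      simp only [PiLp.sub_apply, base_apply_last, sub_zero]
      exact abs_le.2 ⟨by linarith [h1.1], h1.2⟩
    · have h1 := hx j.castSucc
      have h2 := hy j
      simp only [PiLp.sub_apply, base_apply_castSucc]
      exact abs_le.2 ⟨by linarith [h1.1, h2.2], by linarith [h1.2, h2.1]⟩

lemma measurable_inv_norm_pow {n : ℕ} (x : EuclideanSpace ℝ (Fin (n + 1))) :
    Measurable fun y : EuclideanSpace ℝ (Fin n) => (ENNReal.ofReal (‖base y - x‖ ^ n))⁻¹ := by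
  have := continuous_base (n := n)
  refine (ENNReal.measurable_ofReal.comp (Continuous.measurable ?_)).inv
  fun_prop

/-- At height at least h every distance D to the base satisfies r / D ≤ r / h, so the cap estimate
is uniform in the starting point and the error factor comes out of the integral. -/
lemma hitIntensity_le_mul_phi {n : ℕ} (x : EuclideanSpace ℝ (Fin (n + 1))) {h r : ℝ}
    (hr : 0 ≤ r) (hrh : r < h) (hx : h ≤ x (Fin.last n)) :
    hitIntensity x r ≤
      ENNReal.ofReal (capConst n * (r ^ n * (√(1 - (r / h) ^ 2))⁻¹ ^ n)) * phi x := by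
  have hK := (capConst_pos n).le
  have hh : 0 < h := hr.trans_lt hrh
  have hq : 0 < 1 - (r / h) ^ 2 := by
    have : r / h < 1 := (div_lt_one hh).2 hrh
    have : 0 ≤ r / h := by positivity
    nlinarith
  rw [hitIntensity_eq, phi, ← lintegral_const_mul _ (measurable_inv_norm_pow x)]
  refine lintegral_mono fun y => ?_
  have hD := hx.trans (le_norm_sub_base x y)
  have hD0 : 0 < ‖x - base y‖ := hh.trans_le hD
  refine (uniformDirection_hitSet_le _ r hr (hrh.trans_le hD)).trans ?_
  rw [norm_sub_rev (base y), ← ENNReal.ofReal_inv_of_pos (by positivity),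
    ← ENNReal.ofReal_mul (by positivity)]
  refine ENNReal.ofReal_le_ofReal ?_
  rw [mul_assoc]
  gcongr
  rw [← inv_pow, ← mul_pow, ← mul_pow]
  gcongr
  rw [mul_assoc, ← mul_inv, ← div_eq_mul_inv]
  have h1 : √(1 - (r / h) ^ 2) * ‖x - base y‖ ≤ √(‖x - base y‖ ^ 2 - r ^ 2) := by
    refine Real.le_sqrt_of_sq_le ?_
    rw [mul_pow, Real.sq_sqrt hq.le, one_sub_mul, div_pow]
    have : r ^ 2 ≤ r ^ 2 / h ^ 2 * ‖x - base y‖ ^ 2 := by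
      rw [div_mul_eq_mul_div, le_div_iff₀ (by positivity)]
      gcongr
    linarith
  gcongr

lemma mul_phi_le_hitIntensity {n : ℕ} (x : EuclideanSpace ℝ (Fin (n + 1))) {h r : ℝ}
    (hr : 0 ≤ r) (hrh : r < h) (hx : h ≤ x (Fin.last n)) :
    ENNReal.ofReal (capConst n * (r ^ n * √(1 - (r / h) ^ 2))) * phi x ≤ hitIntensity x r := by
  have hK := (capConst_pos n).le
  have hh : 0 < h := hr.trans_lt hrh
  rw [hitIntensity_eq, phi, ← lintegral_const_mul _ (measurable_inv_norm_pow x)]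
  refine lintegral_mono fun y => ?_
  have hD := hx.trans (le_norm_sub_base x y)
  have hD0 : 0 < ‖x - base y‖ := hh.trans_le hD
  refine le_trans ?_ (le_uniformDirection_hitSet _ r hr (hrh.trans_le hD) ?_)
  · rw [norm_sub_rev, ← ENNReal.ofReal_inv_of_pos (by positivity),
      ← ENNReal.ofReal_mul (by positivity)]
    refine ENNReal.ofReal_le_ofReal ?_
    rw [mul_assoc, mul_right_comm, ← inv_pow, ← mul_pow, ← div_eq_mul_inv]
    gcongr
    rw [le_div_iff₀ hD0]
    refine Real.le_sqrt_of_sq_le ?_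
    rw [mul_pow]
    have hq : 0 ≤ 1 - (r / h) ^ 2 := by
      have : r / h < 1 := (div_lt_one hh).2 hrh
      have : 0 ≤ r / h := by positivity
      nlinarith
    rw [Real.sq_sqrt hq, one_sub_mul, div_pow]
    have : r ^ 2 ≤ r ^ 2 / h ^ 2 * ‖x - base y‖ ^ 2 := by
      rw [div_mul_eq_mul_div, le_div_iff₀ (by positivity)]
      gcongr
    linarith
  · simp only [PiLp.sub_apply, base_apply_last, sub_zero]
    linarith

/-- The infimum of `phi` over the unit cube. -/
noncomputable def phiInf (n : ℕ) : ℝ≥0∞ := ⨅ x ∈ unitCube (n + 1), phi x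

lemma phi_le_of_le_last {n : ℕ} (x : EuclideanSpace ℝ (Fin (n + 1))) {h : ℝ} (hh : 0 < h)
    (hx : h ≤ x (Fin.last n)) : phi x ≤ (ENNReal.ofReal (h ^ n))⁻¹ := by
  calc phi x ≤ ∫⁻ _y in unitCube n, (ENNReal.ofReal (h ^ n))⁻¹ := by
        refine lintegral_mono fun y => ?_
        have := hx.trans (le_norm_sub_base x y)
        rw [norm_sub_rev]
        gcongr
    _ = _ := by simp [volume_unitCube]

lemma one_mem_unitCube (n : ℕ) : (WithLp.toLp 2 fun _ => 1 : EuclideanSpace ℝ (Fin n)) ∈ unitCube n :=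
  fun i => by simp

lemma phiInf_lt_top (n : ℕ) : phiInf n < ∞ := by
  refine (iInf₂_le _ (one_mem_unitCube (n + 1))).trans_lt
    ((phi_le_of_le_last _ one_pos (by simp)).trans_lt ?_)
  simp

lemma phiInf_pos (n : ℕ) : 0 < phiInf n := by
  have h0 : 0 < (ENNReal.ofReal (√(n + 1) ^ n))⁻¹ := by simp
  refine h0.trans_le (le_iInf₂ fun x hx => ?_)
  calc (ENNReal.ofReal (√(n + 1) ^ n))⁻¹
      = ∫⁻ _y in unitCube n, (ENNReal.ofReal (√(n + 1) ^ n))⁻¹ := by simp [volume_unitCube]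
    _ ≤ phi x := by
        refine setLIntegral_mono (measurable_inv_norm_pow x) fun y hy => ?_
        have := norm_sub_base_le hx hy
        rw [norm_sub_rev]
        gcongr

/-- Moving x₀ by at most θ h shrinks each distance to the base, itself at least h, by a factor no
smaller than 1 - θ. This one-sided continuity is enough to spread an almost-minimal value of `phi`
over a box. -/
lemma phi_le_of_norm_sub_le {n : ℕ} (x x₀ : EuclideanSpace ℝ (Fin (n + 1))) {h θ : ℝ}
    (hh : 0 < h) (hx₀ : h ≤ x₀ (Fin.last n)) (hθ : θ < 1)
    (hx : ‖x - x₀‖ ≤ θ * h) : phi x ≤ ENNReal.ofReal ((1 - θ)⁻¹ ^ n) * phi x₀ := by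
  rw [phi, phi, ← lintegral_const_mul _ (measurable_inv_norm_pow x₀)]
  refine lintegral_mono fun y => ?_
  have h1 := hx₀.trans (le_norm_sub_base x₀ y)
  have h0 : 0 ≤ θ := by
    by_contra hcon
    push Not at hcon
    nlinarith [norm_nonneg (x - x₀)]
  have h2 : (1 - θ) * ‖base y - x₀‖ ≤ ‖base y - x‖ := by
    have : ‖base y - x₀‖ ≤ ‖base y - x‖ + ‖x - x₀‖ := by
      have := norm_add_le (base y - x) (x - x₀)
      rwa [sub_add_sub_cancel] at this
    rw [norm_sub_rev] at h1
    nlinarith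
  have hp : 0 < ‖base y - x₀‖ := by
    rw [norm_sub_rev] at h1
    linarith
  have hθ' : 0 < 1 - θ := by linarith
  have hp2 : 0 < ‖base y - x‖ := lt_of_lt_of_le (by positivity) h2
  rw [← ENNReal.ofReal_inv_of_pos (by positivity), ← ENNReal.ofReal_inv_of_pos (by positivity),
    ← ENNReal.ofReal_mul (by positivity)]
  refine ENNReal.ofReal_le_ofReal ?_
  rw [← inv_pow, ← inv_pow, ← mul_pow, ← mul_inv]
  gcongr

/-! ### Points near the base -/

/-- The projection of `ℝ^(n+1)` onto its first `n` coordinates. -/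
noncomputable def foot {n : ℕ} (x : EuclideanSpace ℝ (Fin (n + 1))) : EuclideanSpace ℝ (Fin n) :=
  WithLp.toLp 2 fun i => x i.castSucc

lemma norm_sub_base_sq {n : ℕ} (x : EuclideanSpace ℝ (Fin (n + 1)))
    (y : EuclideanSpace ℝ (Fin n)) :
    ‖x - base y‖ ^ 2 = ‖y - foot x‖ ^ 2 + x (Fin.last n) ^ 2 := by
  rw [norm_sub_rev y, EuclideanSpace.norm_sq_eq, EuclideanSpace.norm_sq_eq, Fin.sum_univ_castSucc]
  simp [base_apply_last, base_apply_castSucc, foot]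

/-- The interval at distance between `a` and `2 a` from `u`, on the side with more room in
`[0,1]`. -/
noncomputable def sideInterval (u a : ℝ) : Set ℝ :=
  if u ≤ 1 / 2 then Ioo (u + a) (u + 2 * a) else Ioo (u - 2 * a) (u - a)

lemma measurableSet_sideInterval (u a : ℝ) : MeasurableSet (sideInterval u a) := by
  unfold sideInterval
  split_ifs <;> exact measurableSet_Ioo

lemma volume_sideInterval (u a : ℝ) : volume (sideInterval u a) = ENNReal.ofReal a := by
  unfold sideInterval
  split_ifs <;> rw [Real.volume_Ioo] <;> ring_nf

lemma abs_sub_of_mem_sideInterval {u a w : ℝ} (ha : 0 < a) (h : w ∈ sideInterval u a) :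
    a < |w - u| ∧ |w - u| < 2 * a := by
  unfold sideInterval at h
  split_ifs at h
  · rw [abs_of_pos (by linarith [h.1])]
    exact ⟨by linarith [h.1], by linarith [h.2]⟩
  · rw [abs_of_neg (by linarith [h.2])]
    exact ⟨by linarith [h.2], by linarith [h.1]⟩

lemma mem_Icc_of_mem_sideInterval {u a w : ℝ} (hu : u ∈ Icc (0 : ℝ) 1) (ha : 0 < a)
    (ha2 : a ≤ 1 / 4) (h : w ∈ sideInterval u a) : w ∈ Icc (0 : ℝ) 1 := by
  unfold sideInterval at h
  split_ifs at h with h1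
  · exact ⟨by linarith [h.1, hu.1], by linarith [h.2]⟩
  · exact ⟨by linarith [h.1], by linarith [h.2, hu.2]⟩

/-- Logarithmic divergence of the integral of ‖y - z‖^(-n). At each dyadic scale a there is a box of
side a, at distance of order a from z, which stays in the cube because each coordinate moves towards
the roomier side. Each box contributes at least (2√n)^(-n), and boxes of different scales are
disjoint. -/
lemma le_lintegral_inv_norm_pow {n : ℕ} (hn : 1 ≤ n) (z : EuclideanSpace ℝ (Fin n))
    (hz : z ∈ unitCube n) (J : ℕ) :
    (J : ℝ≥0∞) * ENNReal.ofReal ((2 * √n)⁻¹ ^ n) ≤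
      ∫⁻ y in unitCube n ∩ {y | (1 / 2) ^ (J + 1) ≤ ‖y - z‖}, (ENNReal.ofReal (‖y - z‖ ^ n))⁻¹ := by
  have hn0 : 0 < √n := Real.sqrt_pos.2 (by exact_mod_cast hn)
  let a : ℕ → ℝ := fun j => (1 / 2) ^ (j + 2)
  have ha : ∀ j, 0 < a j := fun j => by positivity
  let G : ℕ → Set (EuclideanSpace ℝ (Fin n)) := fun j => {y | ∀ i, y i ∈ sideInterval (z i) (a j)}
  have hGm : ∀ j, MeasurableSet (G j) := by
    intro j
    have : G j = ⋂ i, (fun y : EuclideanSpace ℝ (Fin n) => y i) ⁻¹' sideInterval (z i) (a j) := by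
      ext y
      simp [G]
    rw [this]
    exact MeasurableSet.iInter fun i =>
      (measurableSet_sideInterval _ _).preimage (by fun_prop)
  have hGv : ∀ j, volume (G j) = ENNReal.ofReal (a j ^ n) := by
    intro j
    simp only [G]
    rw [volume_toLp_pi _ fun i => measurableSet_sideInterval _ _]
    simp [volume_sideInterval, ENNReal.ofReal_pow (ha j).le]
  have hlow : ∀ j, ∀ y ∈ G j, a j ≤ ‖y - z‖ := by
    intro j y hy
    have h1 := (abs_sub_of_mem_sideInterval (ha j) (hy ⟨0, hn⟩)).1
    have h2 := PiLp.norm_apply_le (y - z) ⟨0, hn⟩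
    simp only [PiLp.sub_apply, Real.norm_eq_abs] at h2
    exact h1.le.trans h2
  have hup : ∀ j, ∀ y ∈ G j, ‖y - z‖ ≤ √n * (2 * a j) := by
    intro j y hy
    refine norm_le_sqrt_of_coord _ _ (by have := ha j; positivity) fun i => ?_
    exact (abs_sub_of_mem_sideInterval (ha j) (hy i)).2.le
  have hdisj : Pairwise (fun i j => Disjoint (G i) (G j)) := by
    have key : ∀ i j, i < j → Disjoint (G i) (G j) := by
      intro i j hij
      rw [Set.disjoint_left]
      intro y hi hj
      have h1 := (abs_sub_of_mem_sideInterval (ha i) (hi ⟨0, hn⟩)).1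
      have h2 := (abs_sub_of_mem_sideInterval (ha j) (hj ⟨0, hn⟩)).2
      have h3 : 2 * a j ≤ a i := by
        have : a j ≤ (1 / 2) ^ (i + 1 + 2) :=
          pow_le_pow_of_le_one (by norm_num) (by norm_num) (by omega)
        calc 2 * a j ≤ 2 * (1 / 2) ^ (i + 1 + 2) := by gcongr
          _ = a i := by simp only [a]; ring
      linarith
    intro i j hij
    rcases lt_or_gt_of_ne hij with h | h
    · exact key i j h
    · exact (key j i h).symm
  have hsub : (⋃ j ∈ Finset.range J, G j) ⊆
      unitCube n ∩ {y | (1 / 2) ^ (J + 1) ≤ ‖y - z‖} := by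
    intro y hy
    simp only [mem_iUnion, Finset.mem_range] at hy
    obtain ⟨j, hj, hy⟩ := hy
    refine ⟨fun i => mem_Icc_of_mem_sideInterval (hz i) (ha j) ?_ (hy i), ?_⟩
    · calc a j ≤ (1 / 2) ^ 2 := pow_le_pow_of_le_one (by norm_num) (by norm_num) (by omega)
        _ = 1 / 4 := by norm_num
    · refine le_trans ?_ (hlow j y hy)
      exact pow_le_pow_of_le_one (by norm_num) (by norm_num) (by omega)
  refine le_trans ?_ (lintegral_mono_set hsub)
  rw [lintegral_biUnion_finset (fun i _ j _ hij => hdisj hij) (fun j _ => hGm j)]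
  calc (J : ℝ≥0∞) * ENNReal.ofReal ((2 * √n)⁻¹ ^ n)
      = ∑ _j ∈ Finset.range J, ENNReal.ofReal ((2 * √n)⁻¹ ^ n) := by simp
    _ ≤ _ := by
      refine Finset.sum_le_sum fun j _ => ?_
      have haj := ha j
      calc ENNReal.ofReal ((2 * √n)⁻¹ ^ n)
          = ∫⁻ _y in G j, (ENNReal.ofReal ((√n * (2 * a j)) ^ n))⁻¹ := by
            rw [setLIntegral_const, hGv, ← ENNReal.ofReal_inv_of_pos (by positivity),
              ← ENNReal.ofReal_mul (by positivity), ← inv_pow, ← mul_pow]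
            congr 2
            field_simp
        _ ≤ _ := by
            refine setLIntegral_mono' (hGm j) fun y hy => ?_
            have := hup j y hy
            gcongr

/-- A ball that may dip below the base contains the ball of half the radius whose centre is raised
by r / 2. That one lies in the upper half-space, so the hemisphere cuts off none of its directions.
-/
lemma le_uniformDirection_hitSet_of_nonneg {n : ℕ} (v : EuclideanSpace ℝ (Fin (n + 1))) (r : ℝ)
    (hr : 0 < r) (hv : 2 * r ≤ ‖v‖) (hl : 0 ≤ v (Fin.last n)) :
    ENNReal.ofReal (capConst n * ((r / (4 * ‖v‖)) ^ n / 2)) ≤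
      uniformDirection n (hitSet v r) := by
  have hK := (capConst_pos n).le
  set w := v + (r / 2) • EuclideanSpace.single (Fin.last n) (1 : ℝ) with hw
  have hwv : ‖w - v‖ = r / 2 := by
    simp [hw, norm_smul, abs_of_pos hr]
  have hw1 : ‖v‖ - r / 2 ≤ ‖w‖ := by
    have := norm_sub_norm_le v w
    rw [norm_sub_rev, hwv] at this
    linarith
  have hw2 : ‖w‖ ≤ ‖v‖ + r / 2 := by
    have := norm_sub_norm_le w v
    rw [hwv] at this
    linarith
  have hv0 : 0 < ‖v‖ := by linarith
  have hw0 : 0 < ‖w‖ := by linarith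
  have hsub : hitSet w (r / 2) ⊆ hitSet v r := by
    rintro s ⟨t, ht, h⟩
    refine ⟨t, ht, ?_⟩
    have := norm_add_le (t • s.1 - w) (w - v)
    rw [sub_add_sub_cancel, hwv] at this
    linarith
  refine le_trans ?_ (measure_mono hsub)
  refine le_trans ?_ (le_uniformDirection_hitSet w (r / 2) (by positivity) (by linarith)
    (by simp [hw, hl]))
  refine ENNReal.ofReal_le_ofReal ?_
  rw [div_eq_mul_inv _ (2 : ℝ)]
  gcongr ?_ * (?_ * ?_)
  · refine pow_le_pow_left₀ (by positivity) ?_ n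
    rw [div_le_div_iff₀ (by positivity) (by positivity)]
    nlinarith
  · rw [le_div_iff₀ hw0]
    refine Real.le_sqrt_of_sq_le ?_
    nlinarith

/-- For a point of height at most 2^(-(J+1)), starting points at horizontal distance at least
2^(-(J+1)) have total distance at most twice the horizontal one. Each of the J dyadic scales then
adds a fixed multiple of r^n. -/
lemma le_hitIntensity_of_last_le {n : ℕ} (hn : 1 ≤ n) (x : EuclideanSpace ℝ (Fin (n + 1)))
    (hx : x ∈ unitCube (n + 1)) (J : ℕ) (hxJ : x (Fin.last n) ≤ (1 / 2) ^ (J + 1)) (r : ℝ)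
    (hr : 0 < r) (hrJ : 2 * r ≤ (1 / 2) ^ (J + 1)) :
    ENNReal.ofReal (capConst n * (r ^ n * ((8⁻¹ ^ n / 2) * (J * (2 * √n)⁻¹ ^ n)))) ≤
      hitIntensity x r := by
  have hK := (capConst_pos n).le
  have hfoot : foot x ∈ unitCube n := fun i => hx i.castSucc
  have hx0 : 0 ≤ x (Fin.last n) := (hx _).1
  set B := unitCube n ∩ {y | (1 / 2) ^ (J + 1) ≤ ‖y - foot x‖} with hB
  have hBm : MeasurableSet B := (measurableSet_unitCube n).inter
    (measurableSet_le measurable_const (by fun_prop))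
  have h1 : ENNReal.ofReal (capConst n * (r ^ n * (8⁻¹ ^ n / 2))) *
      ((J : ℝ≥0∞) * ENNReal.ofReal ((2 * √n)⁻¹ ^ n)) ≤ hitIntensity x r := by
    calc _ ≤ ENNReal.ofReal (capConst n * (r ^ n * (8⁻¹ ^ n / 2))) *
          ∫⁻ y in B, (ENNReal.ofReal (‖y - foot x‖ ^ n))⁻¹ :=
          mul_le_mul_right (le_lintegral_inv_norm_pow hn _ hfoot J) _
      _ = ∫⁻ y in B, ENNReal.ofReal (capConst n * (r ^ n * (8⁻¹ ^ n / 2))) *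
            (ENNReal.ofReal (‖y - foot x‖ ^ n))⁻¹ := by
          rw [lintegral_const_mul]
          fun_prop
      _ ≤ ∫⁻ y in B, uniformDirection n (hitSet (x - base y) r) := by
          refine setLIntegral_mono' hBm fun y hy => ?_
          have hy2 : (1 / 2) ^ (J + 1) ≤ ‖y - foot x‖ := hy.2
          have hp : (0 : ℝ) < (1 / 2) ^ (J + 1) := by positivity
          have hp' : 0 < ‖y - foot x‖ := hp.trans_le hy2
          have hsq := norm_sub_base_sq x y
          have hD1 : ‖y - foot x‖ ≤ ‖x - base y‖ :=
            le_of_sq_le_sq (by nlinarith) (norm_nonneg _)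
          have hD2 : ‖x - base y‖ ≤ 2 * ‖y - foot x‖ :=
            le_of_sq_le_sq (by nlinarith) (by positivity)
          have hD0 : 0 < ‖x - base y‖ := hp'.trans_le hD1
          refine le_trans ?_ (le_uniformDirection_hitSet_of_nonneg (x - base y) r hr
            (by linarith) (by simpa [base_apply_last] using hx0))
          rw [← ENNReal.ofReal_inv_of_pos (by positivity), ← ENNReal.ofReal_mul (by positivity)]
          refine ENNReal.ofReal_le_ofReal ?_
          rw [mul_assoc]
          gcongr
          rw [mul_assoc, div_mul_eq_mul_div, mul_div_assoc', ← inv_pow, ← mul_pow, ← mul_pow]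
          gcongr
          rw [← mul_inv, div_eq_mul_inv r]
          exact mul_le_mul_of_nonneg_left (inv_anti₀ (by positivity) (by linarith)) hr.le
      _ ≤ ∫⁻ y in unitCube n, uniformDirection n (hitSet (x - base y) r) :=
          lintegral_mono_set inter_subset_left
      _ = _ := (hitIntensity_eq x r).symm
  refine le_trans (le_of_eq ?_) h1
  rw [← ENNReal.ofReal_natCast, ← ENNReal.ofReal_mul (by positivity),
    ← ENNReal.ofReal_mul (by positivity)]
  congr 1
  ring

/-- J is taken so large that below height h = 2^(-(J+1)) the logarithmic bound already exceeds the
infimum of `phi`. Above h the comparison with `phi` applies, with an error factor tending to 1 as r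
→ 0. -/
lemma exists_forall_le_hitIntensity {n : ℕ} (hn : 1 ≤ n) {m : ℝ}
    (hm : m < capConst n * (phiInf n).toReal) :
    ∃ r₀ > 0, ∀ r, 0 < r → r < r₀ → ∀ x ∈ unitCube (n + 1),
      ENNReal.ofReal (m * r ^ n) ≤ hitIntensity x r := by
  have hK := capConst_pos n
  have hn0 : 0 < √n := Real.sqrt_pos.2 (by exact_mod_cast hn)
  have hΦ : ENNReal.ofReal (phiInf n).toReal = phiInf n := ENNReal.ofReal_toReal (phiInf_lt_top n).ne
  set Φ := (phiInf n).toReal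
  have hc : (0 : ℝ) < (8⁻¹ ^ n / 2) * (2 * √n)⁻¹ ^ n := by positivity
  obtain ⟨J, hJ⟩ := exists_nat_ge (Φ / ((8⁻¹ ^ n / 2) * (2 * √n)⁻¹ ^ n))
  rw [div_le_iff₀ hc] at hJ
  set h : ℝ := (1 / 2) ^ (J + 1) with hh
  have hh0 : 0 < h := by positivity
  have hcont : ContinuousAt (fun r : ℝ => capConst n * √(1 - (r / h) ^ 2) * Φ) 0 := by fun_prop
  have hev : ∀ᶠ r in 𝓝 (0 : ℝ), m < capConst n * √(1 - (r / h) ^ 2) * Φ :=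
    hcont.eventually (lt_mem_nhds (by simpa using hm))
  obtain ⟨ε, hε, hball⟩ := Metric.eventually_nhds_iff.1 hev
  refine ⟨min ε (h / 2), by positivity, fun r hr hr₀ x hx => ?_⟩
  have hr1 := hr₀.trans_le (min_le_left _ _)
  have hr2 := hr₀.trans_le (min_le_right _ _)
  rcases le_total (x (Fin.last n)) h with hxh | hxh
  · refine le_trans ?_ (le_hitIntensity_of_last_le hn x hx J hxh r hr (by linarith))
    refine ENNReal.ofReal_le_ofReal ?_
    calc m * r ^ n ≤ capConst n * Φ * r ^ n := by gcongr
      _ = capConst n * (r ^ n * Φ) := by ring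
      _ ≤ _ := by
        gcongr
        linarith
  · refine le_trans ?_ (mul_phi_le_hitIntensity x hr.le (by linarith) hxh)
    have hle : phiInf n ≤ phi x := iInf₂_le x hx
    refine le_trans ?_ (mul_le_mul_right hle _)
    rw [← hΦ, ← ENNReal.ofReal_mul (by positivity)]
    refine ENNReal.ofReal_le_ofReal ?_
    have := hball (y := r) (by rwa [Real.dist_eq, sub_zero, abs_of_pos hr])
    calc m * r ^ n ≤ capConst n * √(1 - (r / h) ^ 2) * Φ * r ^ n := by gcongr
      _ = _ := by ring

lemma phi_eq_top_of_last_eq_zero {n : ℕ} (hn : 1 ≤ n) {x : EuclideanSpace ℝ (Fin (n + 1))}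
    (hx : x ∈ unitCube (n + 1)) (h0 : x (Fin.last n) = 0) : phi x = ∞ := by
  have hn0 : 0 < √n := Real.sqrt_pos.2 (by exact_mod_cast hn)
  have hfoot : foot x ∈ unitCube n := fun i => hx i.castSucc
  have h1 : ∀ J : ℕ, (J : ℝ≥0∞) * ENNReal.ofReal ((2 * √n)⁻¹ ^ n) ≤ phi x := by
    intro J
    refine (le_lintegral_inv_norm_pow hn _ hfoot J).trans ?_
    refine (lintegral_mono_set inter_subset_left).trans (lintegral_mono fun y => ?_)
    have : ‖base y - x‖ = ‖y - foot x‖ := by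
      rw [norm_sub_rev, ← sq_eq_sq₀ (norm_nonneg _) (norm_nonneg _), norm_sub_base_sq, h0]
      simp
    rw [this]
  have hc : ENNReal.ofReal ((2 * √n)⁻¹ ^ n) ≠ 0 := by
    rw [ENNReal.ofReal_ne_zero_iff]
    positivity
  by_contra hcon
  have h2 : ∀ J : ℕ, (J : ℝ≥0∞) ≤ phi x / ENNReal.ofReal ((2 * √n)⁻¹ ^ n) := fun J =>
    (ENNReal.le_div_iff_mul_le (Or.inl hc) (Or.inl ENNReal.ofReal_ne_top)).2 (h1 J)
  obtain ⟨J, hJ⟩ := ENNReal.exists_nat_gt (ENNReal.div_ne_top hcon hc)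
  exact absurd (h2 J) (not_le.2 hJ)

lemma exists_box_hitIntensity_le {n : ℕ} (hn : 1 ≤ n) {M : ℝ}
    (hM : capConst n * (phiInf n).toReal < M) :
    ∃ a : Fin (n + 1) → ℝ, ∃ η > 0, ∃ h > 0, ∃ r₀ > 0, ∀ x : EuclideanSpace ℝ (Fin (n + 1)),
      (∀ i, x i ∈ Icc (a i) (a i + η)) → x ∈ unitCube (n + 1) ∧ h ≤ x (Fin.last n) ∧
      ∀ r, 0 ≤ r → r < r₀ → hitIntensity x r ≤ ENNReal.ofReal (M * r ^ n) := by
  have hK := capConst_pos n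
  have hA : (phiInf n).toReal < M / capConst n := by
    rw [lt_div_iff₀ hK]
    linarith
  have hΦ0 : 0 ≤ (phiInf n).toReal := ENNReal.toReal_nonneg
  obtain ⟨x₀, hx₀, hphi⟩ : ∃ x ∈ unitCube (n + 1), phi x < ENNReal.ofReal (M / capConst n) := by
    have : phiInf n < ENNReal.ofReal (M / capConst n) := by
      rw [← ENNReal.ofReal_toReal (phiInf_lt_top n).ne]
      exact (ENNReal.ofReal_lt_ofReal_iff (by linarith)).2 hA
    simpa [phiInf, iInf_lt_iff] using this
  -- An almost-minimiser is off the base, since `phi` is infinite there.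
  have hpos : 0 < x₀ (Fin.last n) := by
    refine lt_of_le_of_ne (hx₀ _).1 fun h0 => ?_
    rw [phi_eq_top_of_last_eq_zero hn hx₀ h0.symm] at hphi
    exact absurd hphi (by simp)
  set h₀ := x₀ (Fin.last n) with hh₀
  have hp : phi x₀ = ENNReal.ofReal (phi x₀).toReal := (ENNReal.ofReal_toReal hphi.ne_top).symm
  set p := (phi x₀).toReal with hpdef
  have hp0 : 0 ≤ p := ENNReal.toReal_nonneg
  have hpA : p < M / capConst n := by
    rw [hp] at hphi
    exact (ENNReal.ofReal_lt_ofReal_iff (by linarith)).1 hphi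
  have hcont : ContinuousAt (fun θ : ℝ => capConst n * (√(1 - θ ^ 2))⁻¹ ^ n * ((1 - θ)⁻¹ ^ n * p)) 0 := by
    refine ContinuousAt.mul (ContinuousAt.mul continuousAt_const (ContinuousAt.pow
      (ContinuousAt.inv₀ (by fun_prop) (by simp)) n)) (ContinuousAt.mul (ContinuousAt.pow
      (ContinuousAt.inv₀ (by fun_prop) (by simp)) n) continuousAt_const)
  have hev : ∀ᶠ θ in 𝓝 (0 : ℝ),
      capConst n * (√(1 - θ ^ 2))⁻¹ ^ n * ((1 - θ)⁻¹ ^ n * p) < M := by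
    refine hcont.eventually (gt_mem_nhds ?_)
    rw [lt_div_iff₀ hK] at hpA
    simp
    linarith
  obtain ⟨ε, hε, hball⟩ := Metric.eventually_nhds_iff.1 hev
  -- One θ bounds both the relative displacement from x₀ and the ratio of r to the height h₀ / 2.
  set θ := min (ε / 2) (1 / 2) with hθ
  have hθ0 : 0 < θ := by positivity
  have hθ1 : θ ≤ 1 / 2 := min_le_right _ _
  have hθ2 := hball (y := θ) (by
    rw [Real.dist_eq, sub_zero, abs_of_pos hθ0]
    exact (min_le_left _ _).trans_lt (by linarith))
  have hsn : 1 ≤ √((n : ℝ) + 1) := Real.one_le_sqrt.2 (by linarith [(Nat.cast_nonneg n : (0 : ℝ) ≤ n)])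
  set η := θ * h₀ / √((n : ℝ) + 1) with hη
  have hη0 : 0 < η := by positivity
  have hη1 : η ≤ θ * h₀ := div_le_self (by positivity) hsn
  have hη2 : η ≤ h₀ / 2 := hη1.trans (by nlinarith)
  have hh1 : h₀ ≤ 1 := (hx₀ _).2
  -- Capping the corner at 1 - η keeps the box in the cube when x₀ is near or on its boundary.
  refine ⟨fun i => min (x₀ i) (1 - η), η, hη0, h₀ / 2, by positivity, θ * (h₀ / 2), by positivity,
    fun x hx => ?_⟩
  have hxlast : h₀ / 2 ≤ x (Fin.last n) := by
    refine le_trans (le_min ?_ ?_) (hx (Fin.last n)).1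
    · linarith
    · linarith
  refine ⟨fun i => ⟨le_trans (le_min (hx₀ i).1 (by linarith)) (hx i).1,
    (hx i).2.trans (by linarith [min_le_right (x₀ i) (1 - η)])⟩, hxlast, fun r hr hr₀ => ?_⟩
  have hnorm : ‖x - x₀‖ ≤ θ * h₀ := by
    refine (norm_le_sqrt_of_coord _ η hη0.le fun i => ?_).trans (le_of_eq ?_)
    · have h1 := hx i
      have h2 := hx₀ i
      simp only [PiLp.sub_apply]
      refine abs_le.2 ⟨?_, ?_⟩
      · have : x₀ i - η ≤ min (x₀ i) (1 - η) := le_min (by linarith) (by linarith [h2.2])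
        linarith [h1.1]
      · linarith [h1.2, min_le_left (x₀ i) (1 - η)]
    · push_cast
      rw [hη]
      field_simp
  have h1 := phi_le_of_norm_sub_le x x₀ hpos le_rfl (by linarith) hnorm
  refine (hitIntensity_le_mul_phi x hr (h := h₀ / 2) (by nlinarith) hxlast).trans ?_
  refine (mul_le_mul_right h1 _).trans ?_
  rw [hp, ← ENNReal.ofReal_mul (by have : θ < 1 := by linarith
                                   have : 0 < 1 - θ := by linarith
                                   positivity), ← ENNReal.ofReal_mul (by positivity)]
  refine ENNReal.ofReal_le_ofReal ?_
  have hθ' : 0 < 1 - θ := by linarith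
  have hrθ : r / (h₀ / 2) ≤ θ := by
    rw [div_le_iff₀ (by positivity)]
    exact hr₀.le
  have hs : (√(1 - (r / (h₀ / 2)) ^ 2))⁻¹ ≤ (√(1 - θ ^ 2))⁻¹ := by
    have : 0 < 1 - θ ^ 2 := by nlinarith
    gcongr
  calc capConst n * (r ^ n * (√(1 - (r / (h₀ / 2)) ^ 2))⁻¹ ^ n) * ((1 - θ)⁻¹ ^ n * p)
      ≤ capConst n * (r ^ n * (√(1 - θ ^ 2))⁻¹ ^ n) * ((1 - θ)⁻¹ ^ n * p) := by gcongr
    _ = capConst n * (√(1 - θ ^ 2))⁻¹ ^ n * ((1 - θ)⁻¹ ^ n * p) * r ^ n := by ring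
    _ ≤ M * r ^ n := by gcongr

/-! ### Trajectories meeting two balls -/

/-- A ray reaching height h / 2 within bounded time has vertical component σ bounded below. Two
parallel rays that meet the ball then do so at times at most 2r / σ apart, so their starting points
are O(r) apart. -/
lemma norm_sub_le_of_hitSet {n : ℕ} {x : EuclideanSpace ℝ (Fin (n + 1))}
    (hx : x ∈ unitCube (n + 1)) {h r : ℝ} (hh : 0 < h) (hxh : h ≤ x (Fin.last n))
    (hrh : r ≤ h / 2) {y₁ y₂ : EuclideanSpace ℝ (Fin n)}
    (h₁ : y₁ ∈ unitCube n) {s : Sphere (n + 1)}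
    (hs₁ : s ∈ hitSet (x - base y₁) r) (hs₂ : s ∈ hitSet (x - base y₂) r) :
    ‖y₁ - y₂‖ ≤ (4 * (√((n : ℝ) + 1) + 1) / h + 2) * r := by
  obtain ⟨t₁, ht₁, he₁⟩ := hs₁
  obtain ⟨t₂, ht₂, he₂⟩ := hs₂
  have hs : ‖s.1‖ = 1 := by simp
  have hx1 : x (Fin.last n) ≤ 1 := (hx _).2
  set e₁ := t₁ • s.1 - (x - base y₁) with h_e₁
  set e₂ := t₂ • s.1 - (x - base y₂) with h_e₂
  have hr0 : 0 ≤ r := (norm_nonneg _).trans he₁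
  have hT : t₁ ≤ √(n + 1) + 1 := by
    have h3 : ‖t₁ • s.1‖ = t₁ := by rw [norm_smul, hs, mul_one, Real.norm_of_nonneg ht₁]
    have h4 : t₁ • s.1 = e₁ + (x - base y₁) := by rw [h_e₁]; abel
    have h5 := norm_add_le e₁ (x - base y₁)
    rw [← h4, h3] at h5
    have := norm_sub_base_le hx h₁
    linarith
  have hc₁ := (PiLp.norm_apply_le e₁ (Fin.last n)).trans he₁
  have hc₂ := (PiLp.norm_apply_le e₂ (Fin.last n)).trans he₂
  simp only [h_e₁, h_e₂, PiLp.sub_apply, PiLp.smul_apply, base_apply_last, smul_eq_mul, sub_zero,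
    Real.norm_eq_abs] at hc₁ hc₂
  set σ := s.1 (Fin.last n)
  obtain ⟨hc1, hc2⟩ := abs_le.1 hc₁
  obtain ⟨hc3, hc4⟩ := abs_le.1 hc₂
  have hσ : h / 2 ≤ t₁ * σ := by linarith
  have hσ0 : 0 < σ := by
    by_contra hcon
    push Not at hcon
    nlinarith
  have hσ1 : h / 2 ≤ (√(n + 1) + 1) * σ := hσ.trans (by gcongr)
  have hTpos : 0 < √((n : ℝ) + 1) + 1 := by positivity
  have ht : |t₂ - t₁| ≤ 4 * (√(n + 1) + 1) / h * r := by
    have h6 : |t₂ - t₁| * σ ≤ 2 * r := by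
      rw [← abs_of_pos hσ0, ← abs_mul]
      refine abs_le.2 ⟨by linarith, by linarith⟩
    have h7 : |t₂ - t₁| * (h / 2) ≤ 2 * r * (√(n + 1) + 1) := by
      calc |t₂ - t₁| * (h / 2) ≤ |t₂ - t₁| * ((√(n + 1) + 1) * σ) := by gcongr
        _ = |t₂ - t₁| * σ * (√(n + 1) + 1) := by ring
        _ ≤ _ := by gcongr
    rw [div_mul_eq_mul_div, le_div_iff₀ hh]
    linarith
  have h8 : base y₁ - base y₂ = (t₂ - t₁) • s.1 + (e₁ - e₂) := by
    rw [h_e₁, h_e₂, sub_smul]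
    abel
  rw [← norm_base_sub_base, h8]
  have h9 : ‖(t₂ - t₁) • s.1‖ = |t₂ - t₁| := by rw [norm_smul, hs, mul_one, Real.norm_eq_abs]
  have := norm_add_le ((t₂ - t₁) • s.1) (e₁ - e₂)
  have := norm_sub_le e₁ e₂
  rw [add_mul]
  linarith

/-- Subtracting the two hitting points cancels the starting point. The sign of the time difference
decides which of the two opposite caps contains s. -/
lemma mem_hitSet_or_of_mem_hitSet {m : ℕ} {v w : EuclideanSpace ℝ (Fin m)} {r : ℝ}
    {s : Sphere m} (hv : s ∈ hitSet v r) (hw : s ∈ hitSet w r) :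
    s ∈ hitSet (v - w) (2 * r) ∪ hitSet (w - v) (2 * r) := by
  obtain ⟨t, -, ht⟩ := hv
  obtain ⟨u, -, hu⟩ := hw
  rcases le_total u t with h | h
  · left
    refine ⟨t - u, by linarith, ?_⟩
    have := norm_sub_le (t • s.1 - v) (u • s.1 - w)
    rw [show (t - u) • s.1 - (v - w) = (t • s.1 - v) - (u • s.1 - w) by rw [sub_smul]; abel]
    linarith
  · right
    refine ⟨u - t, by linarith, ?_⟩
    have := norm_sub_le (u • s.1 - w) (t • s.1 - v)
    rw [show (u - t) • s.1 - (w - v) = (u • s.1 - w) - (t • s.1 - v) by rw [sub_smul]; abel]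
    linarith

lemma uniformDirection_hitSet_le_of_four_mul_le {n : ℕ} (v : EuclideanSpace ℝ (Fin (n + 1)))
    {r : ℝ} (hr : 0 ≤ r) (hv0 : 0 < ‖v‖) (hv : 4 * r ≤ ‖v‖) :
    uniformDirection n (hitSet v (2 * r)) ≤
      ENNReal.ofReal (capConst n * (4 * (r / ‖v‖)) ^ n) := by
  have hK := (capConst_pos n).le
  refine (uniformDirection_hitSet_le v (2 * r) (by positivity) (by linarith)).trans
    (ENNReal.ofReal_le_ofReal ?_)
  gcongr
  have h1 : ‖v‖ / 2 ≤ √(‖v‖ ^ 2 - (2 * r) ^ 2) := Real.le_sqrt_of_sq_le (by nlinarith)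
  calc 2 * r / √(‖v‖ ^ 2 - (2 * r) ^ 2) ≤ 2 * r / (‖v‖ / 2) := by gcongr
    _ = 4 * (r / ‖v‖) := by rw [div_div_eq_mul_div]; ring

/-- Integrating over directions last: hitting both balls confines the direction to two caps of
angular size O(r / ‖x - x'‖), and for a given direction the starting points lie in a ball of radius
O(r). -/
lemma exists_hitPairs_inter_le {n : ℕ} {h : ℝ} (hh : 0 < h) :
    ∃ C > 0, ∀ x ∈ unitCube (n + 1), h ≤ x (Fin.last n) → ∀ x' : EuclideanSpace ℝ (Fin (n + 1)),
      ∀ r, 0 ≤ r → r ≤ h / 2 → 0 < ‖x - x'‖ → 4 * r ≤ ‖x - x'‖ →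
      (volume.prod (uniformDirection n)) (hitPairs x r ∩ hitPairs x' r) ≤
        ENNReal.ofReal (C * (r ^ n * (r / ‖x - x'‖) ^ n)) := by
  have hK := capConst_pos n
  have hκ := kappa_toReal_pos n
  set c := 4 * (√((n : ℝ) + 1) + 1) / h + 2
  have hc : 0 < c := by positivity
  refine ⟨c ^ n * (kappa n).toReal * (capConst n * 4 ^ n * 2), by positivity,
    fun x hx hxh x' r hr hrh hd0 hd => ?_⟩
  rw [Measure.prod_apply_symm ((measurableSet_hitPairs x r).inter (measurableSet_hitPairs x' r))]
  set H := hitSet (x - x') (2 * r) ∪ hitSet (x' - x) (2 * r) with hH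
  have hHm : MeasurableSet H := (measurableSet_hitSet _ _).union (measurableSet_hitSet _ _)
  have hsec : ∀ s : Sphere (n + 1),
      volume ((fun y => (y, s)) ⁻¹' (hitPairs x r ∩ hitPairs x' r)) ≤
      H.indicator (fun _ => ENNReal.ofReal ((c * r) ^ n * (kappa n).toReal)) s := by
    intro s
    rcases ((fun y => (y, s)) ⁻¹' (hitPairs x r ∩ hitPairs x' r)).eq_empty_or_nonempty with
      hE | ⟨y₀, hy₀, hy₀'⟩
    · simp [hE]
    · have hs : s ∈ H := by
        have := mem_hitSet_or_of_mem_hitSet hy₀.2 hy₀'.2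
        simpa [hH] using this
      rw [indicator_of_mem hs]
      have hsub : (fun y => (y, s)) ⁻¹' (hitPairs x r ∩ hitPairs x' r) ⊆
          Metric.closedBall y₀ (c * r) := by
        intro y hy
        rw [mem_closedBall_iff_norm]
        exact norm_sub_le_of_hitSet hx hh hxh hrh hy.1.1 hy.1.2 hy₀.2
      refine (measure_mono hsub).trans (le_of_eq ?_)
      rw [Measure.addHaar_closedBall _ _ (by positivity), finrank_euclideanSpace_fin,
        ENNReal.ofReal_mul (by positivity), ENNReal.ofReal_toReal (kappa_lt_top n).ne]
      rfl
  refine (lintegral_mono hsec).trans ?_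
  rw [lintegral_indicator hHm, setLIntegral_const]
  have hHle : uniformDirection n H ≤ ENNReal.ofReal (capConst n * (4 * (r / ‖x - x'‖)) ^ n * 2) := by
    refine (measure_union_le _ _).trans ?_
    rw [mul_two, ENNReal.ofReal_add (by positivity) (by positivity)]
    refine add_le_add (uniformDirection_hitSet_le_of_four_mul_le _ hr hd0 hd) ?_
    rw [norm_sub_rev] at hd hd0 ⊢
    exact uniformDirection_hitSet_le_of_four_mul_le _ hr hd0 hd
  refine (mul_le_mul_right hHle _).trans (le_of_eq ?_)
  rw [← ENNReal.ofReal_mul (by positivity)]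
  rw [mul_pow c r, mul_pow 4]
  congr 1
  ring

/-! ### Void probabilities of marked Poisson processes -/

/-- The Poisson generating function. Counts are values of a measure, hence the extended real
variable and the power through `toReal`. -/
lemma lintegral_rpow_poissonMeasure (l : ℝ≥0) {α : ℝ} (hα : 0 ≤ α) :
    ∫⁻ x, ENNReal.ofReal α ^ x.toReal ∂((poissonMeasure l).map (fun k : ℕ => (k : ℝ≥0∞))) =
      ENNReal.ofReal (Real.exp (-(1 - α) * l)) := by
  rw [lintegral_map (by fun_prop) .of_discrete, poissonMeasure, lintegral_sum_measure]
  simp only [lintegral_smul_measure, lintegral_dirac, ENNReal.toReal_natCast, ENNReal.rpow_natCast,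
    smul_eq_mul]
  have hterm : ∀ k : ℕ, ENNReal.ofReal (Real.exp (-l) * l ^ k / k.factorial) *
      ENNReal.ofReal α ^ k =
      ENNReal.ofReal (Real.exp (-l) * ((α * l) ^ k / k.factorial)) := by
    intro k
    rw [← ENNReal.ofReal_pow hα, ← ENNReal.ofReal_mul (by positivity)]
    congr 1
    rw [mul_pow]
    ring
  simp_rw [hterm]
  have hsum : HasSum (fun k : ℕ => Real.exp (-l) * ((α * l) ^ k / k.factorial))
      (Real.exp (-(1 - α) * l)) := by
    have h := (NormedSpace.expSeries_div_hasSum_exp (α * (l : ℝ))).mul_left (Real.exp (-l))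
    rw [← Real.exp_eq_exp_ℝ, ← Real.exp_add] at h
    rwa [show -(1 - α) * (l : ℝ) = -l + α * l by ring]
  rw [← ENNReal.ofReal_tsum_of_nonneg (fun k => by positivity) hsum.summable, hsum.tsum_eq]

lemma IsPoissonProcess.lintegral_prod_rpow {Ω E : Type*} [MeasurableSpace Ω] [MeasurableSpace E]
    {η : Ω → Measure E} {μ : Measure E} {P : Measure Ω} [IsProbabilityMeasure P]
    (h : IsPoissonProcess η μ P) {k : ℕ} (B : Fin k → Set E) (hB : ∀ j, MeasurableSet (B j))
    (hdisj : Pairwise (fun i j => Disjoint (B i) (B j))) (hfin : ∀ j, μ (B j) < ∞)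
    (α : Fin k → ℝ) (hα : ∀ j, 0 ≤ α j) :
    ∫⁻ ω, ∏ j, ENNReal.ofReal (α j) ^ (η ω (B j)).toReal ∂P =
      ENNReal.ofReal (Real.exp (-∑ j, (1 - α j) * (μ (B j)).toReal)) := by
  have hm : ∀ j, Measurable fun ω => η ω (B j) := fun j =>
    (Measure.measurable_coe (hB j)).comp h.measurable
  have hg : ∀ j, Measurable fun x : ℝ≥0∞ => ENNReal.ofReal (α j) ^ x.toReal := fun j => by fun_prop
  have hind : iIndepFun (fun j ω => ENNReal.ofReal (α j) ^ (η ω (B j)).toReal) P :=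
    (h.indep k B hB hdisj).comp (fun j x => ENNReal.ofReal (α j) ^ x.toReal) hg
  rw [lintegral_prod_eq_prod_lintegral_of_indepFun Finset.univ _ hind
    (fun j => (hg j).comp (hm j))]
  have h1 : ∀ j, ∫⁻ ω, ENNReal.ofReal (α j) ^ (η ω (B j)).toReal ∂P =
      ENNReal.ofReal (Real.exp (-((1 - α j) * (μ (B j)).toReal))) := by
    intro j
    rw [← lintegral_map (f := fun x : ℝ≥0∞ => ENNReal.ofReal (α j) ^ x.toReal) (hg j) (hm j),
      h.law _ (hB j) (hfin j), lintegral_rpow_poissonMeasure _ (hα j), neg_mul]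
    rfl
  simp_rw [h1]
  rw [← ENNReal.ofReal_prod_of_nonneg fun j _ => (Real.exp_pos _).le, ← Real.exp_sum,
    Finset.sum_neg_distrib]

lemma sum_dirac_apply_eq_card {E : Type*} [MeasurableSpace E] {y : ℕ → E} {B C : Set E}
    (hB : MeasurableSet B) (hBC : B ⊆ C) (hC : {i | y i ∈ C}.Finite) [DecidablePred (· ∈ B)] :
    (Measure.sum fun i => Measure.dirac (y i)) B =
      ((hC.toFinset.filter fun i => y i ∈ B).card : ℝ≥0∞) := by
  rw [Measure.sum_apply _ hB]
  simp_rw [Measure.dirac_apply' _ hB]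
  rw [tsum_eq_sum (s := hC.toFinset), Finset.card_filter]
  · push_cast
    refine Finset.sum_congr rfl fun i _ => ?_
    by_cases hi : y i ∈ B <;> simp [hi]
  · intro i hi
    have : y i ∉ B := fun hy => hi (by simpa using hBC hy)
    simp [this]

lemma finite_of_sum_dirac_apply_ne_top {E : Type*} [MeasurableSpace E] {y : ℕ → E} {C : Set E}
    (hCm : MeasurableSet C)
    (h : (Measure.sum fun i => Measure.dirac (y i)) C ≠ ∞) : {i | y i ∈ C}.Finite := by
  rw [Measure.sum_apply _ hCm] at h
  refine (ENNReal.finite_const_le_of_tsum_ne_top h one_ne_zero).subset fun i (hi : y i ∈ C) => ?_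
  change 1 ≤ Measure.dirac (y i) C
  rw [Measure.dirac_apply' _ hCm]
  simp [hi]

lemma IsPoissonProcess.ae_lt_top {Ω E : Type*} [MeasurableSpace Ω] [MeasurableSpace E]
    {η : Ω → Measure E} {μ : Measure E} {P : Measure Ω}
    (h : IsPoissonProcess η μ P) {C : Set E} (hC : MeasurableSet C) (hfin : μ C < ∞) :
    ∀ᵐ ω ∂P, η ω C ≠ ∞ := by
  have hm : Measurable fun ω => η ω C := (Measure.measurable_coe hC).comp h.measurable
  have h1 : ∀ᵐ x ∂(P.map fun ω => η ω C), x ≠ ∞ := by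
    rw [h.law C hC hfin]
    exact (ae_map_iff (p := fun x => x ≠ ∞) Measurable.of_discrete.aemeasurable
      (measurableSet_singleton ∞).compl).2 (Eventually.of_forall fun k => ENNReal.natCast_ne_top k)
  exact ae_of_ae_map hm.aemeasurable h1

/-- Grouping the points by their level turns a product over points into powers of the counts, to
which independence over disjoint sets applies. -/
lemma prod_comp_eq_prod_rpow {E : Type*} [MeasurableSpace E] {y : ℕ → E} {C : Set E}
    (hCm : MeasurableSet C) (hC : {i | y i ∈ C}.Finite) {k : ℕ} {β : E → Fin k}
    (hβ : Measurable β) (a : Fin k → ℝ≥0∞) :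
    ∏ i ∈ hC.toFinset, a (β (y i)) =
      ∏ j, a j ^ ((Measure.sum fun i => Measure.dirac (y i)) (C ∩ β ⁻¹' {j})).toReal := by
  classical
  rw [← Finset.prod_fiberwise' hC.toFinset (fun i => β (y i)) a]
  refine Finset.prod_congr rfl fun j _ => ?_
  rw [sum_dirac_apply_eq_card (hCm.inter (hβ (measurableSet_singleton j))) inter_subset_left hC,
    Finset.prod_const, ENNReal.toReal_natCast, ENNReal.rpow_natCast]
  congr 2
  ext i
  simp +contextual

lemma infinitePi_forall_notMem {E Θ : Type*} [MeasurableSpace E] [MeasurableSpace Θ]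
    (ν : Measure Θ) [IsProbabilityMeasure ν] {A : Set (E × Θ)} (hA : MeasurableSet A) {C : Set E}
    (hAC : ∀ p ∈ A, p.1 ∈ C) (y : ℕ → E) (hC : {i | y i ∈ C}.Finite) :
    Measure.infinitePi (fun _ : ℕ => ν) {s | ∀ i, (y i, s i) ∉ A} =
      ∏ i ∈ hC.toFinset, (1 - ν (Prod.mk (y i) ⁻¹' A)) := by
  have hset : {s : ℕ → Θ | ∀ i, (y i, s i) ∉ A} =
      Set.pi hC.toFinset fun i => (Prod.mk (y i) ⁻¹' A)ᶜ := by
    ext s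
    simp only [mem_ofPred_eq, Set.mem_pi, Finset.mem_coe, Set.Finite.mem_toFinset, mem_compl_iff,
      mem_preimage]
    exact ⟨fun h i _ => h i, fun h i hi => h i (hAC _ hi) hi⟩
  rw [hset, Measure.infinitePi_pi _ fun i _ => (measurable_prodMk_left hA).compl]
  exact Finset.prod_congr rfl fun i _ => prob_compl_eq_one_sub (measurable_prodMk_left hA)

/-- Conditioning on the starting points: the joint law of all points and marks is a product, and the
marks alone have an infinite product law. -/
lemma measure_forall_notMem_eq_lintegral {Ω E Θ : Type*} [MeasurableSpace Ω] [MeasurableSpace E]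
    [MeasurableSpace Θ] {P : Measure Ω} [IsProbabilityMeasure P] {Y : ℕ → Ω → E}
    {S : ℕ → Ω → Θ} (hY : ∀ i, Measurable (Y i)) (hS : ∀ i, Measurable (S i)) {ν : Measure Θ}
    [IsProbabilityMeasure ν] (hlaw : ∀ i, P.map (S i) = ν) (hind : iIndepFun S P)
    (hYS : IndepFun (fun ω i => Y i ω) (fun ω i => S i ω) P)
    {A : Set (E × Θ)} (hA : MeasurableSet A) :
    P {ω | ∀ i, (Y i ω, S i ω) ∉ A} =
      ∫⁻ ω, Measure.infinitePi (fun _ : ℕ => ν) {s | ∀ i, (Y i ω, s i) ∉ A} ∂P := by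
  have hY' : Measurable fun ω i => Y i ω := measurable_pi_lambda _ hY
  have hS' : Measurable fun ω i => S i ω := measurable_pi_lambda _ hS
  have hmap := (indepFun_iff_map_prod_eq_prod_map_map hY'.aemeasurable hS'.aemeasurable).1 hYS
  rw [hind.map_fun_eq_infinitePi_map₀ hS'.aemeasurable] at hmap
  simp_rw [hlaw] at hmap
  set T : Set ((ℕ → E) × (ℕ → Θ)) := ⋂ i, {p | (p.1 i, p.2 i) ∉ A} with hT
  have hTm : MeasurableSet T := by
    refine MeasurableSet.iInter fun i => ?_
    have : Measurable fun p : (ℕ → E) × (ℕ → Θ) => (p.1 i, p.2 i) := by fun_prop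
    exact this hA.compl
  have h1 : P {ω | ∀ i, (Y i ω, S i ω) ∉ A} =
      P.map (fun ω => ((fun i => Y i ω), fun i => S i ω)) T := by
    rw [Measure.map_apply (hY'.prodMk hS') hTm]
    congr 1
    ext ω
    simp [hT]
  rw [h1, hmap, Measure.prod_apply hTm, lintegral_map (measurable_measure_prodMk_left hTm) hY']
  refine lintegral_congr fun ω => ?_
  congr 1
  ext s
  simp [hT]

/-- The void probability of an independently marked Poisson process. -/
theorem measure_forall_notMem_eq_exp {Ω E Θ : Type*} [MeasurableSpace Ω] [MeasurableSpace E]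
    [MeasurableSpace Θ] {P : Measure Ω} [IsProbabilityMeasure P] {Y : ℕ → Ω → E}
    {S : ℕ → Ω → Θ} (hY : ∀ i, Measurable (Y i)) (hS : ∀ i, Measurable (S i)) {ν : Measure Θ}
    [IsProbabilityMeasure ν] (hlaw : ∀ i, P.map (S i) = ν) (hind : iIndepFun S P)
    (hYS : IndepFun (fun ω i => Y i ω) (fun ω i => S i ω) P) {μ : Measure E} [SFinite μ]
    (hη : IsPoissonProcess (fun ω => Measure.sum fun i => Measure.dirac (Y i ω)) μ P)
    {A : Set (E × Θ)} (hA : MeasurableSet A) {C : Set E} (hCm : MeasurableSet C)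
    (hμC : μ C < ∞) (hAC : ∀ p ∈ A, p.1 ∈ C) :
    P {ω | ∀ i, (Y i ω, S i ω) ∉ A} = ENNReal.ofReal (Real.exp (-((μ.prod ν) A).toReal)) := by
  set q : E → ℝ := fun y => (ν (Prod.mk y ⁻¹' A)).toReal with hq
  have hqm : Measurable q := (measurable_measure_prodMk_left hA).ennreal_toReal
  have hq0 : ∀ y, 0 ≤ q y := fun y => ENNReal.toReal_nonneg
  have hq1 : ∀ y, q y ≤ 1 := fun y => ENNReal.toReal_le_of_le_ofReal zero_le_one (by simpa using prob_le_one)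
  have hqν : ∀ y, 1 - ν (Prod.mk y ⁻¹' A) = ENNReal.ofReal (1 - q y) := by
    intro y
    rw [ENNReal.ofReal_sub _ (hq0 y), ENNReal.ofReal_one, ENNReal.ofReal_toReal (measure_ne_top _ _)]
  have : IsFiniteMeasure (μ.restrict C) := ⟨by simpa using hμC⟩
  have hqi : IntegrableOn q C μ := by
    refine Integrable.of_bound hqm.aestronglyMeasurable 1 (Eventually.of_forall fun y => ?_)
    rw [Real.norm_of_nonneg (hq0 y)]
    exact hq1 y
  have hI : ((μ.prod ν) A).toReal = ∫ y in C, q y ∂μ := by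
    rw [Measure.prod_apply hA, integral_eq_lintegral_of_nonneg_ae
      (Eventually.of_forall hq0) hqm.aestronglyMeasurable, ← lintegral_indicator hCm]
    congr 2 with y
    by_cases hy : y ∈ C
    · rw [indicator_of_mem hy, ENNReal.ofReal_toReal (measure_ne_top _ _)]
    · rw [indicator_of_notMem hy]
      have : Prod.mk y ⁻¹' A = ∅ := by
        ext s
        simp only [mem_preimage, mem_empty_iff_false, iff_false]
        exact fun h => hy (hAC _ h)
      simp [this]
  set I := ∫ y in C, q y ∂μ with hIdef
  set c := (μ C).toReal with hc
  -- two-sided bounds by discretisation of the hitting probabilities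
  have key : ∀ k : ℕ, 0 < k →
      ENNReal.ofReal (Real.exp (-(I + c / k))) ≤ P {ω | ∀ i, (Y i ω, S i ω) ∉ A} ∧
      P {ω | ∀ i, (Y i ω, S i ω) ∉ A} ≤ ENNReal.ofReal (Real.exp (-(I - c / k))) := by
    intro k hk
    have hk0 : (0 : ℝ) < k := by exact_mod_cast hk
    -- There are k + 1 levels because q = 1 falls in level k.
    let β : E → Fin (k + 1) := fun y => ⟨⌊k * q y⌋₊, by
      refine Nat.lt_succ_of_le (Nat.floor_le_of_le ?_)
      nlinarith [hq1 y]⟩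
    have hβm : Measurable β := by
      refine measurable_to_countable' fun j => ?_
      have : β ⁻¹' {j} = (fun y => ⌊k * q y⌋₊) ⁻¹' {j.1} := by
        ext y
        simp [β, Fin.ext_iff]
      rw [this]
      exact (Nat.measurable_floor.comp (hqm.const_mul _)) (measurableSet_singleton _)
    have hβ1 : ∀ y, ((β y : ℕ) : ℝ) / k ≤ q y := fun y => by
      rw [div_le_iff₀ hk0, mul_comm]
      exact Nat.floor_le (by have := hq0 y; positivity)
    have hβ2 : ∀ y, q y ≤ (((β y : ℕ) : ℝ) + 1) / k := fun y => by
      rw [le_div_iff₀ hk0, mul_comm]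
      exact (Nat.lt_floor_add_one _).le
    let B : Fin (k + 1) → Set E := fun j => C ∩ β ⁻¹' {j}
    have hBm : ∀ j, MeasurableSet (B j) := fun j => hCm.inter (hβm (measurableSet_singleton j))
    have hBd : Pairwise (fun i j => Disjoint (B i) (B j)) := by
      intro i j hij
      rw [Set.disjoint_left]
      rintro y ⟨-, hi⟩ ⟨-, hj⟩
      simp only [mem_preimage, mem_singleton_iff] at hi hj
      exact hij (hi.symm.trans hj)
    have hBf : ∀ j, μ (B j) < ∞ := fun j => (measure_mono inter_subset_left).trans_lt hμC
    have hBU : ⋃ j, B j = C := by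
      ext y
      simp [B]
    have hIsum : I = ∑ j, ∫ y in B j, q y ∂μ := by
      rw [hIdef, ← hBU]
      exact integral_iUnion_fintype hBm hBd fun j => hqi.mono_set inter_subset_left
    have hcsum : c = ∑ j, (μ (B j)).toReal := by
      rw [hc, ← hBU, measure_iUnion hBd hBm, tsum_fintype, ENNReal.toReal_sum fun j _ => (hBf j).ne]
    have hlow : ∀ j : Fin (k + 1), ((j : ℕ) : ℝ) / k * (μ (B j)).toReal ≤ ∫ y in B j, q y ∂μ := by
      intro j
      rw [mul_comm, ← smul_eq_mul, ← Measure.real, ← setIntegral_const]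
      refine setIntegral_mono_on (integrableOn_const (hBf j).ne) (hqi.mono_set inter_subset_left)
        (hBm j) fun y hy => ?_
      have : β y = j := hy.2
      rw [← this]
      exact hβ1 y
    have hup : ∀ j : Fin (k + 1),
        ∫ y in B j, q y ∂μ ≤ (((j : ℕ) : ℝ) + 1) / k * (μ (B j)).toReal := by
      intro j
      rw [mul_comm, ← smul_eq_mul, ← Measure.real, ← setIntegral_const]
      refine setIntegral_mono_on (hqi.mono_set inter_subset_left) (integrableOn_const (hBf j).ne)
        (hBm j) fun y hy => ?_
      have : β y = j := hy.2
      rw [← this]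
      exact hβ2 y
    have hsplit : ∑ j : Fin (k + 1), (((j : ℕ) : ℝ) + 1) / k * (μ (B j)).toReal =
        ∑ j : Fin (k + 1), ((j : ℕ) : ℝ) / k * (μ (B j)).toReal + c / k := by
      rw [hcsum, Finset.sum_div, ← Finset.sum_add_distrib]
      refine Finset.sum_congr rfl fun j _ => ?_
      ring
    have hsum1 : ∑ j : Fin (k + 1), ((j : ℕ) : ℝ) / k * (μ (B j)).toReal ≤ I := by
      rw [hIsum]
      exact Finset.sum_le_sum fun j _ => hlow j
    have hsum2 : I ≤ ∑ j : Fin (k + 1), (((j : ℕ) : ℝ) + 1) / k * (μ (B j)).toReal := by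
      rw [hIsum]
      exact Finset.sum_le_sum fun j _ => hup j
    have hfin := hη.ae_lt_top hCm hμC
    rw [measure_forall_notMem_eq_lintegral hY hS hlaw hind hYS hA]
    constructor
    · have hα : ∀ j : Fin (k + 1), 0 ≤ max 0 (1 - (((j : ℕ) : ℝ) + 1) / k) := fun j => le_max_left _ _
      have h1 := hη.lintegral_prod_rpow B hBm hBd hBf _ hα
      refine le_trans (ENNReal.ofReal_le_ofReal (Real.exp_le_exp.2 (neg_le_neg ?_)))
        (h1.symm.le.trans (lintegral_mono_ae ?_))
      · calc ∑ j : Fin (k + 1), (1 - max 0 (1 - (((j : ℕ) : ℝ) + 1) / k)) * (μ (B j)).toReal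
            ≤ ∑ j : Fin (k + 1), (((j : ℕ) : ℝ) + 1) / k * (μ (B j)).toReal := by
              refine Finset.sum_le_sum fun j _ => ?_
              gcongr
              linarith [le_max_right 0 (1 - (((j : ℕ) : ℝ) + 1) / k)]
          _ ≤ I + c / k := by rw [hsplit]; linarith
      · filter_upwards [hfin] with ω hω
        have hF := finite_of_sum_dirac_apply_ne_top hCm hω
        rw [← prod_comp_eq_prod_rpow hCm hF hβm
          (fun j => ENNReal.ofReal (max 0 (1 - (((j : ℕ) : ℝ) + 1) / k))),
          infinitePi_forall_notMem ν hA hAC _ hF]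
        refine Finset.prod_le_prod' fun i _ => ?_
        rw [hqν]
        refine ENNReal.ofReal_le_ofReal (max_le ?_ ?_)
        · linarith [hq1 (Y i ω)]
        · linarith [hβ2 (Y i ω)]
    · have hα : ∀ j : Fin (k + 1), 0 ≤ 1 - ((j : ℕ) : ℝ) / k := fun j => by
        rw [sub_nonneg, div_le_one hk0]
        exact_mod_cast Nat.lt_succ_iff.1 j.2
      have h1 := hη.lintegral_prod_rpow B hBm hBd hBf _ hα
      refine le_trans (le_trans (lintegral_mono_ae ?_) h1.le)
        (ENNReal.ofReal_le_ofReal (Real.exp_le_exp.2 (neg_le_neg ?_)))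
      · filter_upwards [hfin] with ω hω
        have hF := finite_of_sum_dirac_apply_ne_top hCm hω
        rw [← prod_comp_eq_prod_rpow hCm hF hβm (fun j => ENNReal.ofReal (1 - ((j : ℕ) : ℝ) / k)),
          infinitePi_forall_notMem ν hA hAC _ hF]
        refine Finset.prod_le_prod' fun i _ => ?_
        rw [hqν]
        exact ENNReal.ofReal_le_ofReal (by linarith [hβ1 (Y i ω)])
      · simp only [sub_sub_cancel]
        linarith
  rw [hI]
  have hlim : Tendsto (fun k : ℕ => c / (k : ℝ)) atTop (𝓝 0) :=
    tendsto_const_nhds.div_atTop tendsto_natCast_atTop_atTop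
  refine le_antisymm ?_ ?_
  · have h1 : Tendsto (fun k : ℕ => ENNReal.ofReal (Real.exp (-(I - c / k)))) atTop
        (𝓝 (ENNReal.ofReal (Real.exp (-(I - 0))))) :=
      ENNReal.tendsto_ofReal ((Real.continuous_exp.tendsto _).comp
        (tendsto_const_nhds.sub hlim).neg)
    rw [sub_zero] at h1
    exact ge_of_tendsto h1 ((eventually_gt_atTop 0).mono fun k hk => (key k hk).2)
  · have h1 : Tendsto (fun k : ℕ => ENNReal.ofReal (Real.exp (-(I + c / k)))) atTop
        (𝓝 (ENNReal.ofReal (Real.exp (-(I + 0))))) :=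
      ENNReal.tendsto_ofReal ((Real.continuous_exp.tendsto _).comp
        (tendsto_const_nhds.add hlim).neg)
    rw [add_zero] at h1
    exact le_of_tendsto h1 ((eventually_gt_atTop 0).mono fun k hk => (key k hk).1)

/-! ### Coverage of finite grids -/

lemma mem_cylinderSet_iff {n : ℕ} {y : ℕ → EuclideanSpace ℝ (Fin n)} {s : ℕ → Sphere (n + 1)}
    {x : EuclideanSpace ℝ (Fin (n + 1))} {r : ℝ} (hr : 0 ≤ r) :
    x ∈ cylinderSet y s (r • Metric.closedBall (0 : EuclideanSpace ℝ (Fin (n + 1))) 1) ↔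
      ∃ i, (y i, s i) ∈ hitPairs x r := by
  rw [smul_unitClosedBall_of_nonneg hr]
  simp only [cylinderSet, mem_iUnion, Set.mem_add, exists_prop]
  refine exists_congr fun i => and_congr_right fun _ => ⟨?_, ?_⟩
  · rintro ⟨_, ⟨t, ht, rfl⟩, w, hw, rfl⟩
    refine ⟨t, ht, ?_⟩
    rw [mem_closedBall_zero_iff] at hw
    have : t • (s i).1 - (base (y i) + t • (s i).1 + w - base (y i)) = -w := by abel
    dsimp only
    rwa [this, norm_neg]
  · rintro ⟨t, ht, h⟩
    refine ⟨_, ⟨t, ht, rfl⟩, x - base (y i) - t • (s i).1, ?_, by abel⟩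
    rw [mem_closedBall_zero_iff, norm_sub_rev]
    exact h

lemma hitPairs_mono {n : ℕ} {x g : EuclideanSpace ℝ (Fin (n + 1))} {r r' : ℝ}
    (h : ‖x - g‖ + r' ≤ r) : hitPairs g r' ⊆ hitPairs x r := by
  rintro p ⟨hp, t, ht, h2⟩
  refine ⟨hp, t, ht, ?_⟩
  have := norm_sub_le (t • p.2.1 - (g - base p.1)) (x - g)
  rw [show t • p.2.1 - (g - base p.1) - (x - g) = t • p.2.1 - (x - base p.1) by abel] at this
  linarith

lemma exists_hitPairs_of_coverageRadius_lt {n : ℕ} {y : ℕ → EuclideanSpace ℝ (Fin n)}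
    {s : ℕ → Sphere (n + 1)} {r : ℝ}
    (h : coverageRadius y s (Metric.closedBall 0 1) < ENNReal.ofReal r)
    {x : EuclideanSpace ℝ (Fin (n + 1))} (hx : x ∈ unitCube (n + 1)) :
    ∃ i, (y i, s i) ∈ hitPairs x r := by
  simp only [coverageRadius, iInf_lt_iff] at h
  obtain ⟨q, hq, hqr⟩ := h
  have hqr' : (q : ℝ) ≤ r := by
    rw [ENNReal.ofReal, ENNReal.coe_lt_coe] at hqr
    exact ((Real.lt_toNNReal_iff_coe_lt).1 hqr).le
  obtain ⟨i, hi⟩ := (mem_cylinderSet_iff q.2).1 (hq hx)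
  exact ⟨i, hitPairs_mono (by simpa using hqr') hi⟩

lemma coverageRadius_le {n : ℕ} {y : ℕ → EuclideanSpace ℝ (Fin n)}
    {s : ℕ → Sphere (n + 1)} {r : ℝ} (hr : 0 ≤ r)
    (h : ∀ x ∈ unitCube (n + 1), ∃ i, (y i, s i) ∈ hitPairs x r) :
    coverageRadius y s (Metric.closedBall 0 1) ≤ ENNReal.ofReal r := by
  have : unitCube (n + 1) ⊆ cylinderSet y s ((r.toNNReal : ℝ) •
      Metric.closedBall (0 : EuclideanSpace ℝ (Fin (n + 1))) 1) := by
    intro x hx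
    rw [Real.coe_toNNReal r hr]
    exact (mem_cylinderSet_iff hr).2 (h x hx)
  exact iInf₂_le (f := fun (q : ℝ≥0) (_ : unitCube (n + 1) ⊆ cylinderSet y s ((q : ℝ) •
    Metric.closedBall (0 : EuclideanSpace ℝ (Fin (n + 1))) 1)) => (q : ℝ≥0∞)) r.toNNReal this

/-- The points of the grid with corner `a` and mesh `δ`. -/
noncomputable def gridPoint {m k : ℕ} (a : Fin m → ℝ) (δ : ℝ) (j : Fin m → Fin k) :
    EuclideanSpace ℝ (Fin m) :=
  WithLp.toLp 2 fun i => a i + (j i : ℕ) * δ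

lemma gridPoint_mem_unitCube {m k : ℕ} (hk : 0 < k) (j : Fin m → Fin k) :
    gridPoint 0 (k : ℝ)⁻¹ j ∈ unitCube m := by
  have hk0 : (0 : ℝ) < k := by exact_mod_cast hk
  intro i
  have : ((j i : ℕ) : ℝ) ≤ k := by exact_mod_cast (j i).2.le
  simp only [gridPoint, Pi.zero_apply, zero_add, mem_Icc]
  refine ⟨by positivity, ?_⟩
  rw [← div_eq_mul_inv, div_le_one hk0]
  exact this

lemma exists_gridPoint_near {m k : ℕ} (hk : 0 < k) {x : EuclideanSpace ℝ (Fin m)}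
    (hx : x ∈ unitCube m) :
    ∃ j : Fin m → Fin k, ‖x - gridPoint 0 (k : ℝ)⁻¹ j‖ ≤ √m / k := by
  have hk0 : (0 : ℝ) < k := by exact_mod_cast hk
  -- The minimum handles x i = 1, where the floor is k.
  refine ⟨fun i => ⟨min ⌊k * x i⌋₊ (k - 1), by omega⟩, ?_⟩
  rw [div_eq_mul_inv]
  refine norm_le_sqrt_of_coord _ _ (by positivity) fun i => ?_
  obtain ⟨h0, h1⟩ := hx i
  have h2 : ((min ⌊k * x i⌋₊ (k - 1) : ℕ) : ℝ) ≤ k * x i := by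
    refine le_trans (by exact_mod_cast min_le_left _ _) (Nat.floor_le (by positivity))
  have h3 : k * x i ≤ ((min ⌊k * x i⌋₊ (k - 1) : ℕ) : ℝ) + 1 := by
    rcases le_total ⌊k * x i⌋₊ (k - 1) with h | h
    · rw [min_eq_left h]
      exact (Nat.lt_floor_add_one _).le
    · rw [min_eq_right h, Nat.cast_sub hk]
      push_cast
      nlinarith
  simp only [PiLp.sub_apply, gridPoint, Pi.zero_apply, zero_add]
  rw [show x i - ((min ⌊k * x i⌋₊ (k - 1) : ℕ) : ℝ) * (k : ℝ)⁻¹ =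
    (k * x i - ((min ⌊k * x i⌋₊ (k - 1) : ℕ) : ℝ)) * (k : ℝ)⁻¹ by field_simp, abs_mul,
    abs_of_nonneg (by linarith), abs_of_pos (by positivity)]
  nlinarith [inv_pos.2 hk0]

lemma gridPoint_mem_box {m k : ℕ} (hk : 0 < k) (a : Fin m → ℝ) {η : ℝ} (hη : 0 ≤ η)
    (j : Fin m → Fin k) (i : Fin m) : gridPoint a (η / k) j i ∈ Icc (a i) (a i + η) := by
  have hk0 : (0 : ℝ) < k := by exact_mod_cast hk
  have : ((j i : ℕ) : ℝ) ≤ k := by exact_mod_cast (j i).2.le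
  simp only [gridPoint, mem_Icc]
  refine ⟨by linarith [show 0 ≤ ((j i : ℕ) : ℝ) * (η / k) by positivity], ?_⟩
  rw [mul_div_assoc', add_le_add_iff_left, div_le_iff₀ hk0]
  nlinarith

lemma le_norm_gridPoint_sub {m k : ℕ} (a : Fin m → ℝ) {δ : ℝ} (hδ : 0 ≤ δ)
    {j j' : Fin m → Fin k} (h : j ≠ j') : δ ≤ ‖gridPoint a δ j - gridPoint a δ j'‖ := by
  obtain ⟨i, hi⟩ := Function.ne_iff.1 h
  refine le_trans ?_ (PiLp.norm_apply_le _ i)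
  simp only [PiLp.sub_apply, gridPoint, Real.norm_eq_abs]
  rw [show a i + (j i : ℕ) * δ - (a i + (j' i : ℕ) * δ) = (((j i : ℕ) : ℝ) - (j' i : ℕ)) * δ by ring,
    abs_mul, abs_of_nonneg hδ]
  have h1 : (1 : ℝ) ≤ |((j i : ℕ) : ℝ) - (j' i : ℕ)| := by
    have h2 : ((j i : ℕ) : ℤ) - (j' i : ℕ) ≠ 0 := by
      rw [sub_ne_zero]
      exact_mod_cast fun h => hi (Fin.ext h)
    exact_mod_cast Int.one_le_abs h2
  nlinarith

lemma IsLineModel.measure_forall_notMem {Ω : Type*} [MeasurableSpace Ω] {P : Measure Ω}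
    [IsProbabilityMeasure P] {n : ℕ} {ρ : ℝ} (hρ : 0 ≤ ρ)
    {Y : ℕ → Ω → EuclideanSpace ℝ (Fin n)} {S : ℕ → Ω → Sphere (n + 1)}
    (h : IsLineModel ρ Y S P) {A : Set (EuclideanSpace ℝ (Fin n) × Sphere (n + 1))}
    (hA : MeasurableSet A) (hAC : ∀ p ∈ A, p.1 ∈ unitCube n) :
    P.real {ω | ∀ i, (Y i ω, S i ω) ∉ A} =
      Real.exp (-(ρ * (volume.prod (uniformDirection n)).real A)) := by
  have : IsProbabilityMeasure (uniformDirection n) := by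
    rw [← h.direction_law 0]
    exact Measure.isProbabilityMeasure_map (h.measurable_direction 0).aemeasurable
  rw [Measure.real, measure_forall_notMem_eq_exp h.measurable_start h.measurable_direction
    h.direction_law h.direction_indep h.start_indep_direction h.poisson hA
    (measurableSet_unitCube n) (by
      rw [Measure.smul_apply, volume_unitCube]
      simp) hAC, ENNReal.toReal_ofReal (Real.exp_pos _).le, Measure.prod_smul_left,
    Measure.smul_apply, smul_eq_mul, ENNReal.toReal_mul, ENNReal.toReal_ofReal hρ]
  rfl

/-- The event that no trajectory meets the closed ball of radius `r` about `x`. -/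
def missEvent {Ω : Type*} {n : ℕ} (Y : ℕ → Ω → EuclideanSpace ℝ (Fin n))
    (S : ℕ → Ω → Sphere (n + 1)) (x : EuclideanSpace ℝ (Fin (n + 1))) (r : ℝ) : Set Ω :=
  {ω | ∀ i, (Y i ω, S i ω) ∉ hitPairs x r}

lemma IsLineModel.measurableSet_missEvent {Ω : Type*} [MeasurableSpace Ω] {P : Measure Ω}
    {n : ℕ} {ρ : ℝ} {Y : ℕ → Ω → EuclideanSpace ℝ (Fin n)} {S : ℕ → Ω → Sphere (n + 1)}
    (h : IsLineModel ρ Y S P) (x : EuclideanSpace ℝ (Fin (n + 1))) (r : ℝ) :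
    MeasurableSet (missEvent Y S x r) := by
  have : missEvent Y S x r = ⋂ i, (fun ω => (Y i ω, S i ω)) ⁻¹' (hitPairs x r)ᶜ := by
    ext ω
    simp [missEvent]
  rw [this]
  exact MeasurableSet.iInter fun i => ((h.measurable_start i).prodMk (h.measurable_direction i))
    (measurableSet_hitPairs x r).compl

lemma IsLineModel.measureReal_missEvent {Ω : Type*} [MeasurableSpace Ω] {P : Measure Ω}
    [IsProbabilityMeasure P] {n : ℕ} {ρ : ℝ} (hρ : 0 ≤ ρ)
    {Y : ℕ → Ω → EuclideanSpace ℝ (Fin n)} {S : ℕ → Ω → Sphere (n + 1)}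
    (h : IsLineModel ρ Y S P) (x : EuclideanSpace ℝ (Fin (n + 1))) (r : ℝ) :
    P.real (missEvent Y S x r) = Real.exp (-(ρ * (hitIntensity x r).toReal)) :=
  h.measure_forall_notMem hρ (measurableSet_hitPairs x r) fun _ hp => hp.1

lemma hitIntensity_lt_top {n : ℕ} (x : EuclideanSpace ℝ (Fin (n + 1))) (r : ℝ) :
    hitIntensity x r < ∞ := by
  rw [hitIntensity_eq]
  calc ∫⁻ y in unitCube n, uniformDirection n (hitSet (x - base y) r)
      ≤ ∫⁻ _y in unitCube n, uniformDirection n univ :=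
        lintegral_mono fun y => measure_mono (subset_univ _)
    _ < ∞ := by
        rw [setLIntegral_const, volume_unitCube, mul_one]
        exact measure_lt_top _ _

/-- Inclusion–exclusion in the exponent of the void probability: only trajectories that hit both
balls correlate the two events. -/
lemma IsLineModel.measureReal_missEvent_inter {Ω : Type*} [MeasurableSpace Ω] {P : Measure Ω}
    [IsProbabilityMeasure P] {n : ℕ} {ρ : ℝ} (hρ : 0 ≤ ρ)
    {Y : ℕ → Ω → EuclideanSpace ℝ (Fin n)} {S : ℕ → Ω → Sphere (n + 1)}
    (h : IsLineModel ρ Y S P) (x x' : EuclideanSpace ℝ (Fin (n + 1))) (r : ℝ) :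
    P.real (missEvent Y S x r ∩ missEvent Y S x' r) =
      P.real (missEvent Y S x r) * P.real (missEvent Y S x' r) *
        Real.exp (ρ * (volume.prod (uniformDirection n)).real (hitPairs x r ∩ hitPairs x' r)) := by
  have hset : missEvent Y S x r ∩ missEvent Y S x' r =
      {ω | ∀ i, (Y i ω, S i ω) ∉ hitPairs x r ∪ hitPairs x' r} := by
    ext ω
    simp [missEvent, forall_and]
  have hunion := measureReal_union_add_inter (μ := volume.prod (uniformDirection n))
    (s := hitPairs x r) (t := hitPairs x' r) (measurableSet_hitPairs x' r)
    (hitIntensity_lt_top x r).ne (hitIntensity_lt_top x' r).ne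
  rw [hset, h.measure_forall_notMem hρ ((measurableSet_hitPairs x r).union
    (measurableSet_hitPairs x' r)) (by rintro p (hp | hp) <;> exact hp.1),
    h.measureReal_missEvent hρ, h.measureReal_missEvent hρ, ← Real.exp_add, ← Real.exp_add]
  congr 1
  have : (volume.prod (uniformDirection n)).real (hitPairs x r ∪ hitPairs x' r) =
      (hitIntensity x r).toReal + (hitIntensity x' r).toReal -
        (volume.prod (uniformDirection n)).real (hitPairs x r ∩ hitPairs x' r) := by
    rw [eq_sub_iff_add_eq, hunion]
    rfl
  rw [this]
  ring

/-- Every point of the cube is within √(n+1) / k of the grid, so hitting all grid balls of radius r'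
gives coverage at radius r; a union bound over the k^(n+1) grid points finishes. -/
lemma IsLineModel.measure_lt_coverageRadius_le {Ω : Type*} [MeasurableSpace Ω] {P : Measure Ω}
    [IsProbabilityMeasure P] {n : ℕ} {ρ : ℝ} (hρ : 0 ≤ ρ)
    {Y : ℕ → Ω → EuclideanSpace ℝ (Fin n)} {S : ℕ → Ω → Sphere (n + 1)}
    (h : IsLineModel ρ Y S P) {k : ℕ} (hk : 0 < k) {r r' L : ℝ} (hr' : 0 ≤ r')
    (hr : √((n + 1 : ℕ) : ℝ) / k + r' ≤ r)
    (hL : ∀ x ∈ unitCube (n + 1), ENNReal.ofReal L ≤ hitIntensity x r') :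
    P {ω | ENNReal.ofReal r < coverageRadius (fun i => Y i ω) (fun i => S i ω)
      (Metric.closedBall 0 1)} ≤ ENNReal.ofReal ((k : ℝ) ^ (n + 1) * Real.exp (-(ρ * L))) := by
  have hsub : {ω | ENNReal.ofReal r < coverageRadius (fun i => Y i ω) (fun i => S i ω)
      (Metric.closedBall 0 1)} ⊆
      ⋃ j : Fin (n + 1) → Fin k, missEvent Y S (gridPoint 0 (k : ℝ)⁻¹ j) r' := by
    intro ω hω
    by_contra hcon
    simp only [mem_iUnion, not_exists, missEvent, mem_ofPred_eq, not_forall, not_not] at hcon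
    refine absurd (coverageRadius_le (r := r) (le_trans (by positivity) hr) fun x hx => ?_)
      (not_le.2 hω)
    obtain ⟨j, hj⟩ := exists_gridPoint_near hk hx
    obtain ⟨i, hi⟩ := hcon j
    exact ⟨i, hitPairs_mono (by linarith) hi⟩
  refine (measure_mono hsub).trans ((measure_iUnion_fintype_le _ _).trans ?_)
  have hj : ∀ j : Fin (n + 1) → Fin k, P (missEvent Y S (gridPoint 0 (k : ℝ)⁻¹ j) r') ≤
      ENNReal.ofReal (Real.exp (-(ρ * L))) := by
    intro j
    rw [← ofReal_measureReal (measure_ne_top _ _), h.measureReal_missEvent hρ]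
    refine ENNReal.ofReal_le_ofReal (Real.exp_le_exp.2 (neg_le_neg ?_))
    gcongr
    exact (ENNReal.ofReal_le_iff_le_toReal (hitIntensity_lt_top _ _).ne).1
      (hL _ (gridPoint_mem_unitCube hk j))
  refine (Finset.sum_le_sum fun j _ => hj j).trans (le_of_eq ?_)
  rw [ENNReal.ofReal_mul (by positivity), ENNReal.ofReal_pow (by positivity)]
  simp

/-- Second moment method: the number Z of events that occur has mean m and variance at most m + κ
m², and Z = 0 forces (Z - m)² ≥ m². -/
lemma measureReal_iInter_compl_le_of_pairwise {Ω ι : Type*} [MeasurableSpace Ω] {P : Measure Ω}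
    [IsProbabilityMeasure P] [Fintype ι] {A : ι → Set Ω} (hA : ∀ i, MeasurableSet (A i))
    {κ : ℝ} (hκ : 0 ≤ κ) (hpos : 0 < ∑ i, P.real (A i))
    (hpair : ∀ i j, i ≠ j → P.real (A i ∩ A j) ≤ (1 + κ) * (P.real (A i) * P.real (A j))) :
    P.real (⋂ i, (A i)ᶜ) ≤ (∑ i, P.real (A i))⁻¹ + κ := by
  classical
  set m := ∑ i, P.real (A i) with hm
  let Z : Ω → ℝ := fun ω => ∑ i, (A i).indicator 1 ω
  have hint : ∀ i, Integrable ((A i).indicator (1 : Ω → ℝ)) P := fun i =>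
    (integrable_const 1).indicator (hA i)
  have hint2 : ∀ i j, Integrable ((A i ∩ A j).indicator (1 : Ω → ℝ)) P := fun i j =>
    (integrable_const 1).indicator ((hA i).inter (hA j))
  have hZ : Integrable Z P := integrable_finsetSum _ fun i _ => hint i
  have hZsq : (fun ω => Z ω ^ 2) = fun ω => ∑ i, ∑ j, (A i ∩ A j).indicator (1 : Ω → ℝ) ω := by
    ext ω
    simp only [Z, sq, Finset.sum_mul_sum]
    refine Finset.sum_congr rfl fun i _ => Finset.sum_congr rfl fun j _ => ?_
    by_cases h1 : ω ∈ A i <;> by_cases h2 : ω ∈ A j <;> simp [h1, h2]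
  have hZ2 : Integrable (fun ω => Z ω ^ 2) P := by
    rw [hZsq]
    exact integrable_finsetSum _ fun i _ => integrable_finsetSum _ fun j _ => hint2 i j
  have hEZ : ∫ ω, Z ω ∂P = m := by
    rw [integral_finsetSum _ fun i _ => hint i]
    exact Finset.sum_congr rfl fun i _ => integral_indicator_one (hA i)
  have hEZ2 : ∫ ω, Z ω ^ 2 ∂P ≤ m + (1 + κ) * m ^ 2 := by
    rw [hZsq, integral_finsetSum _ fun i _ => integrable_finsetSum _ fun j _ => hint2 i j]
    have h1 : ∀ i, ∫ ω, ∑ j, (A i ∩ A j).indicator (1 : Ω → ℝ) ω ∂P ≤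
        P.real (A i) + (1 + κ) * (P.real (A i) * m) := by
      intro i
      rw [integral_finsetSum _ fun j _ => hint2 i j, hm, Finset.mul_sum, Finset.mul_sum,
        ← Finset.add_sum_erase _ _ (Finset.mem_univ i)]
      refine add_le_add ?_ ?_
      · rw [integral_indicator_one ((hA i).inter (hA i)), inter_self]
      · refine (Finset.sum_le_sum (g := fun j => (1 + κ) * (P.real (A i) * P.real (A j)))
          fun j hj => ?_).trans
          (Finset.sum_le_sum_of_subset_of_nonneg (Finset.erase_subset _ _) fun j _ _ => by positivity)
        rw [integral_indicator_one ((hA i).inter (hA j))]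
        exact hpair i j (Finset.ne_of_mem_erase hj).symm
    refine (Finset.sum_le_sum fun i _ => h1 i).trans (le_of_eq ?_)
    rw [Finset.sum_add_distrib, ← Finset.mul_sum, ← Finset.sum_mul]
    ring
  have hexp : (fun ω => (Z ω - m) ^ 2) = fun ω => Z ω ^ 2 - 2 * m * Z ω + m ^ 2 := by
    ext ω
    ring
  have hint3 : Integrable (fun ω => Z ω ^ 2 - 2 * m * Z ω) P := hZ2.sub (hZ.const_mul _)
  have hint4 : Integrable (fun ω => (Z ω - m) ^ 2) P := hexp ▸ hint3.add (integrable_const _)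
  have hvar : ∫ ω, (Z ω - m) ^ 2 ∂P ≤ m + κ * m ^ 2 := by
    rw [hexp, integral_add hint3 (integrable_const _),
      integral_sub hZ2 (hZ.const_mul _), integral_const_mul, hEZ]
    simp
    linarith
  have hmarkov := mul_meas_ge_le_integral_of_nonneg
    (Eventually.of_forall fun ω => sq_nonneg (Z ω - m)) hint4 (m ^ 2)
  have hsub : (⋂ i, (A i)ᶜ) ⊆ {ω | m ^ 2 ≤ (Z ω - m) ^ 2} := by
    intro ω hω
    simp only [mem_iInter, mem_compl_iff] at hω
    have : Z ω = 0 := Finset.sum_eq_zero fun i _ => by simp [hω i]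
    simp [this]
  have h2 : m ^ 2 * P.real (⋂ i, (A i)ᶜ) ≤ m + κ * m ^ 2 :=
    (mul_le_mul_of_nonneg_left (measureReal_mono hsub) (sq_nonneg m)).trans (hmarkov.trans hvar)
  have h3 : P.real (⋂ i, (A i)ᶜ) ≤ (m + κ * m ^ 2) / m ^ 2 := by
    rw [le_div_iff₀ (by positivity)]
    linarith
  refine h3.trans (le_of_eq ?_)
  field_simp

lemma IsLineModel.measure_coverageRadius_lt_le {Ω : Type*} [MeasurableSpace Ω] {P : Measure Ω}
    [IsProbabilityMeasure P] {n : ℕ} {ρ : ℝ} (hρ : 0 ≤ ρ)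
    {Y : ℕ → Ω → EuclideanSpace ℝ (Fin n)} {S : ℕ → Ω → Sphere (n + 1)}
    (h : IsLineModel ρ Y S P) {ι : Type*} [Fintype ι] [Nonempty ι]
    (g : ι → EuclideanSpace ℝ (Fin (n + 1))) (hg : ∀ j, g j ∈ unitCube (n + 1)) {r U V : ℝ}
    (hU0 : 0 ≤ U) (hV0 : 0 ≤ V) (hU : ∀ j, hitIntensity (g j) r ≤ ENNReal.ofReal U)
    (hV : ∀ i j, i ≠ j → (volume.prod (uniformDirection n))
      (hitPairs (g i) r ∩ hitPairs (g j) r) ≤ ENNReal.ofReal V) :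
    P {ω | coverageRadius (fun i => Y i ω) (fun i => S i ω) (Metric.closedBall 0 1) <
      ENNReal.ofReal r} ≤
      ENNReal.ofReal ((Fintype.card ι * Real.exp (-(ρ * U)))⁻¹ + (Real.exp (ρ * V) - 1)) := by
  have hsub : {ω | coverageRadius (fun i => Y i ω) (fun i => S i ω) (Metric.closedBall 0 1) <
      ENNReal.ofReal r} ⊆ ⋂ j, (missEvent Y S (g j) r)ᶜ := by
    intro ω hω
    simp only [mem_iInter, mem_compl_iff, missEvent, mem_ofPred_eq, not_forall, not_not]
    exact fun j => exists_hitPairs_of_coverageRadius_lt hω (hg j)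
  refine (measure_mono hsub).trans ?_
  rw [← ofReal_measureReal (measure_ne_top _ _)]
  refine ENNReal.ofReal_le_ofReal ?_
  have hp : ∀ j, Real.exp (-(ρ * U)) ≤ P.real (missEvent Y S (g j) r) := by
    intro j
    rw [h.measureReal_missEvent hρ]
    refine Real.exp_le_exp.2 (neg_le_neg ?_)
    gcongr
    exact ENNReal.toReal_le_of_le_ofReal hU0 (hU j)
  have hsum : Fintype.card ι * Real.exp (-(ρ * U)) ≤ ∑ j, P.real (missEvent Y S (g j) r) := by
    rw [← nsmul_eq_mul]
    exact Finset.card_nsmul_le_sum _ _ _ fun j _ => hp j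
  have hcard : (0 : ℝ) < Fintype.card ι * Real.exp (-(ρ * U)) := by
    have : (0 : ℝ) < Fintype.card ι := by exact_mod_cast Fintype.card_pos
    positivity
  refine (measureReal_iInter_compl_le_of_pairwise (κ := Real.exp (ρ * V) - 1)
    (fun j => h.measurableSet_missEvent (g j) r) ?_ (hcard.trans_le hsum) fun i j hij => ?_).trans ?_
  · have := Real.one_le_exp (show 0 ≤ ρ * V by positivity)
    linarith
  · rw [h.measureReal_missEvent_inter hρ, add_sub_cancel, mul_comm (Real.exp _)]
    gcongr
    exact ENNReal.toReal_le_of_le_ofReal hV0 (hV i j hij)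
  · gcongr

/-! ### Asymptotics -/

/-- The order `(log ρ / ρ) ^ (1 / n)` of the coverage radius. -/
noncomputable def radiusScale (n : ℕ) (ρ : ℝ) : ℝ := (Real.log ρ / ρ) ^ (1 / (n : ℝ))

lemma radiusScale_pow {n : ℕ} (hn : 1 ≤ n) {ρ : ℝ} (hρ : 1 ≤ ρ) :
    radiusScale n ρ ^ n = Real.log ρ / ρ := by
  have := Real.log_nonneg hρ
  rw [radiusScale, one_div, Real.rpow_inv_natCast_pow (by positivity) (by omega)]

lemma radiusScale_pos {n : ℕ} {ρ : ℝ} (hρ : 1 < ρ) : 0 < radiusScale n ρ := by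
  have := Real.log_pos hρ
  unfold radiusScale
  positivity

lemma tendsto_radiusScale {n : ℕ} (hn : 1 ≤ n) : Tendsto (radiusScale n) atTop (𝓝 0) := by
  have hn0 : (0 : ℝ) < n := by exact_mod_cast hn
  have h1 : Tendsto (fun ρ : ℝ => Real.log ρ / ρ) atTop (𝓝 0) :=
    Real.isLittleO_log_id_atTop.tendsto_div_nhds_zero
  have h2 := h1.rpow_const (p := 1 / (n : ℝ)) (Or.inr (by positivity))
  rwa [Real.zero_rpow (by positivity)] at h2

lemma rpow_inv_le_radiusScale {n : ℕ} {ρ : ℝ} (hρ : Real.exp 1 ≤ ρ) :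
    (ρ ^ (1 / (n : ℝ)))⁻¹ ≤ radiusScale n ρ := by
  have hρ0 : 0 < ρ := (Real.exp_pos 1).trans_le hρ
  have h1 : 1 ≤ Real.log ρ := (Real.le_log_iff_exp_le hρ0).2 hρ
  rw [radiusScale, ← Real.inv_rpow hρ0.le]
  refine Real.rpow_le_rpow (by positivity) ?_ (by positivity)
  rw [inv_eq_one_div]
  gcongr

lemma exp_neg_mul_log {ρ : ℝ} (hρ : 0 < ρ) (q : ℝ) : Real.exp (-(q * Real.log ρ)) = ρ ^ (-q) := by
  rw [Real.rpow_def_of_pos hρ]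
  congr 1
  ring

lemma tendsto_measure_lt_coverageRadius {Ω : Type*} [MeasurableSpace Ω] {P : Measure Ω}
    [IsProbabilityMeasure P] {n : ℕ} (hn : 1 ≤ n)
    {Y : ℝ → ℕ → Ω → EuclideanSpace ℝ (Fin n)} {S : ℝ → ℕ → Ω → Sphere (n + 1)}
    (hmodel : ∀ ρ : ℝ, 0 < ρ → IsLineModel ρ (Y ρ) (S ρ) P) {b t : ℝ} (hb : 0 < b) (ht : 0 < t)
    (hbn : ((n : ℝ) + 1) / n < capConst n * (phiInf n).toReal * b ^ n) :
    Tendsto (fun ρ => P {ω | ENNReal.ofReal ((b + t) * radiusScale n ρ) <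
      coverageRadius (fun i => Y ρ i ω) (fun i => S ρ i ω) (Metric.closedBall 0 1)})
      atTop (𝓝 0) := by
  have hn0 : (0 : ℝ) < n := by exact_mod_cast hn
  obtain ⟨m, hm1, hm2⟩ := exists_between ((div_lt_iff₀ (by positivity)).2 hbn)
  rw [div_lt_iff₀ (by positivity)] at hm1
  have hm0 : 0 < m := by
    have : 0 < m * b ^ n := lt_trans (by positivity) hm1
    exact pos_of_mul_pos_left this (by positivity)
  obtain ⟨r₀, hr₀, hL⟩ := exists_forall_le_hitIntensity hn hm2
  -- Chosen so that a grid with k ≥ C ρ^(1/n) has covering error at most t ρ^(-1/n), which is at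
  -- most t times `radiusScale` once log ρ ≥ 1.
  set C : ℝ := √((n + 1 : ℕ) : ℝ) / t with hC
  have hC0 : 0 < C := by
    have : (0 : ℝ) < ((n + 1 : ℕ) : ℝ) := by positivity
    positivity
  have hlim : Tendsto (fun ρ : ℝ => ENNReal.ofReal ((C + 1) ^ (n + 1) *
      ρ ^ (-(m * b ^ n - ((n : ℝ) + 1) / n)))) atTop (𝓝 0) := by
    have := (tendsto_rpow_neg_atTop (sub_pos.2 hm1)).const_mul ((C + 1) ^ (n + 1))
    simpa using ENNReal.tendsto_ofReal this
  have hsmall : ∀ᶠ ρ in atTop, b * radiusScale n ρ < r₀ := by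
    have := (tendsto_radiusScale hn).const_mul b
    rw [mul_zero] at this
    exact this.eventually (gt_mem_nhds hr₀)
  refine tendsto_of_tendsto_of_tendsto_of_le_of_le' tendsto_const_nhds hlim
    (Eventually.of_forall fun _ => zero_le) ?_
  filter_upwards [hsmall, eventually_ge_atTop (Real.exp 1)] with ρ hρ₀ hρe
  have hρ1 : 1 < ρ := lt_of_lt_of_le (by simp) hρe
  have hρ0 : 0 < ρ := by linarith
  have ha := radiusScale_pos (n := n) hρ1
  have hpow := radiusScale_pow hn hρ1.le
  have hone : 1 ≤ ρ ^ (1 / (n : ℝ)) := Real.one_le_rpow hρ1.le (by positivity)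
  have hk : 0 < ⌈C * ρ ^ (1 / (n : ℝ))⌉₊ := Nat.ceil_pos.2 (by positivity)
  set k := ⌈C * ρ ^ (1 / (n : ℝ))⌉₊ with hkdef
  have hk0 : (0 : ℝ) < k := by exact_mod_cast hk
  have hk1 : C * ρ ^ (1 / (n : ℝ)) ≤ k := Nat.le_ceil _
  have hk2 : (k : ℝ) ≤ (C + 1) * ρ ^ (1 / (n : ℝ)) := by
    have : (k : ℝ) < C * ρ ^ (1 / (n : ℝ)) + 1 := Nat.ceil_lt_add_one (by positivity)
    linarith
  refine ((hmodel ρ hρ0).measure_lt_coverageRadius_le hρ0.le hk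
    (r' := b * radiusScale n ρ) (by positivity) ?_
    (hL _ (by positivity) hρ₀)).trans (ENNReal.ofReal_le_ofReal ?_)
  · have h1 : √((n + 1 : ℕ) : ℝ) / k ≤ t * radiusScale n ρ := by
      calc √((n + 1 : ℕ) : ℝ) / k = C * t / k := by rw [hC, div_mul_cancel₀ _ ht.ne']
        _ ≤ C * t / (C * ρ ^ (1 / (n : ℝ))) := by gcongr
        _ = t * (ρ ^ (1 / (n : ℝ)))⁻¹ := by field_simp
        _ ≤ _ := by
          gcongr
          exact rpow_inv_le_radiusScale hρe
    linarith
  · have h2 : ρ * (m * (b * radiusScale n ρ) ^ n) = m * b ^ n * Real.log ρ := by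
      rw [mul_pow, hpow]
      field_simp
    rw [h2, exp_neg_mul_log hρ0]
    calc (k : ℝ) ^ (n + 1) * ρ ^ (-(m * b ^ n))
        ≤ ((C + 1) * ρ ^ (1 / (n : ℝ))) ^ (n + 1) * ρ ^ (-(m * b ^ n)) := by gcongr
      _ = (C + 1) ^ (n + 1) * (ρ ^ (((n : ℝ) + 1) / n) * ρ ^ (-(m * b ^ n))) := by
          rw [mul_pow, ← Real.rpow_natCast (ρ ^ (1 / (n : ℝ))), ← Real.rpow_mul hρ0.le, mul_assoc]
          congr 3
          push_cast
          ring
      _ = _ := by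
          rw [← Real.rpow_add hρ0]
          congr 2
          ring

lemma tendsto_log_rpow_mul_rpow_neg (p : ℝ) {s : ℝ} (hs : 0 < s) :
    Tendsto (fun ρ : ℝ => Real.log ρ ^ p * ρ ^ (-s)) atTop (𝓝 0) := by
  refine (isLittleO_log_rpow_rpow_atTop p hs).tendsto_div_nhds_zero.congr' ?_
  filter_upwards [eventually_gt_atTop 0] with ρ hρ
  rw [Real.rpow_neg hρ.le, div_eq_mul_inv]

lemma tendsto_measure_coverageRadius_lt {Ω : Type*} [MeasurableSpace Ω] {P : Measure Ω}
    [IsProbabilityMeasure P] {n : ℕ} (hn : 1 ≤ n)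
    {Y : ℝ → ℕ → Ω → EuclideanSpace ℝ (Fin n)} {S : ℝ → ℕ → Ω → Sphere (n + 1)}
    (hmodel : ∀ ρ : ℝ, 0 < ρ → IsLineModel ρ (Y ρ) (S ρ) P) {b : ℝ} (hb : 0 < b)
    (hbn : capConst n * (phiInf n).toReal * b ^ n < ((n : ℝ) + 1) / n) :
    Tendsto (fun ρ => P {ω | coverageRadius (fun i => Y ρ i ω) (fun i => S ρ i ω)
      (Metric.closedBall 0 1) < ENNReal.ofReal (b * radiusScale n ρ)}) atTop (𝓝 0) := by
  have hn0 : (0 : ℝ) < n := by exact_mod_cast hn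
  obtain ⟨M, hM1, hM2⟩ := exists_between ((lt_div_iff₀ (by positivity)).2 hbn)
  rw [lt_div_iff₀ (by positivity)] at hM2
  have hM0 : 0 < M := lt_of_le_of_lt (mul_nonneg (capConst_pos n).le ENNReal.toReal_nonneg) hM1
  obtain ⟨a, η, hη, h, hh, r₀, hr₀, hbox⟩ := exists_box_hitIntensity_le hn hM1
  obtain ⟨C, hC, hpair⟩ := exists_hitPairs_inter_le (n := n) hh
  -- With about ρ^(e(n+1)) grid points, the lower bound on e makes the expected number of missed
  -- points diverge. The upper bound makes the spacing ρ^(-e) much larger than r, so that the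
  -- correlation exponent, of order (log ρ)² ρ^(-(1 - e n)), vanishes.
  obtain ⟨e, he1, he2⟩ : ∃ e, M * b ^ n / ((n : ℝ) + 1) < e ∧ e < 1 / (n : ℝ) := by
    refine exists_between ?_
    rw [div_lt_iff₀ (by positivity)]
    calc M * b ^ n < _ := hM2
      _ = _ := by ring
  have he0 : 0 < e := lt_trans (by positivity) he1
  rw [div_lt_iff₀ (by positivity)] at he1
  have hen : e * n < 1 := by rwa [lt_div_iff₀ hn0] at he2
  set D : ℝ := C * b ^ n * (b / η) ^ n with hD
  have hD0 : 0 < D := by positivity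
  have hlim : Tendsto (fun ρ : ℝ => ENNReal.ofReal (2 ^ (n + 1) * ρ ^ (-(e * ((n : ℝ) + 1) - M * b ^ n)) +
      (Real.exp (D * (Real.log ρ ^ (2 : ℝ) * ρ ^ (-(1 - e * n)))) - 1))) atTop (𝓝 0) := by
    have h1 := (tendsto_rpow_neg_atTop (sub_pos.2 he1)).const_mul (2 ^ (n + 1))
    have h2 := (Real.continuous_exp.tendsto _).comp
      ((tendsto_log_rpow_mul_rpow_neg 2 (sub_pos.2 hen)).const_mul D)
    have h3 := ENNReal.tendsto_ofReal (h1.add (h2.sub_const 1))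
    simpa using h3
  have hsmall : ∀ᶠ ρ in atTop, b * radiusScale n ρ < min r₀ (h / 2) := by
    have := (tendsto_radiusScale hn).const_mul b
    rw [mul_zero] at this
    exact this.eventually (gt_mem_nhds (by positivity))
  have hsmall2 : ∀ᶠ ρ in atTop,
      4 * b * (Real.log ρ ^ (1 / (n : ℝ)) * ρ ^ (-(1 / (n : ℝ) - e))) < η := by
    have := (tendsto_log_rpow_mul_rpow_neg (1 / (n : ℝ)) (sub_pos.2 he2)).const_mul (4 * b)
    rw [mul_zero] at this
    exact this.eventually (gt_mem_nhds hη)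
  refine tendsto_of_tendsto_of_tendsto_of_le_of_le' tendsto_const_nhds hlim
    (Eventually.of_forall fun _ => zero_le) ?_
  filter_upwards [hsmall, hsmall2, eventually_gt_atTop 1,
    (tendsto_rpow_atTop he0).eventually (eventually_ge_atTop 2)] with ρ hρ₀ hρη hρ1 hρ2
  have hρ0 : 0 < ρ := by linarith
  have hr1 := hρ₀.trans_le (min_le_left _ _)
  have hr2 := hρ₀.trans_le (min_le_right _ _)
  have ha := radiusScale_pos (n := n) hρ1
  have hpow := radiusScale_pow hn hρ1.le
  have hlog := Real.log_pos hρ1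
  set k := ⌊ρ ^ e⌋₊ with hkdef
  have hk1 : (k : ℝ) ≤ ρ ^ e := Nat.floor_le (by positivity)
  -- Uses ρ^e ≥ 2, so that rounding down loses at most half.
  have hk2 : ρ ^ e / 2 ≤ k := by
    have : ρ ^ e < k + 1 := Nat.lt_floor_add_one _
    linarith
  have hk0 : (0 : ℝ) < k := by linarith
  have hk : 0 < k := by exact_mod_cast hk0
  set r := b * radiusScale n ρ with hr
  have hr0 : 0 < r := by positivity
  have hrk : 4 * r ≤ η / k := by
    rw [le_div_iff₀ hk0]
    refine le_trans ?_ hρη.le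
    calc 4 * r * k ≤ 4 * r * ρ ^ e := by gcongr
      _ = 4 * b * (radiusScale n ρ * ρ ^ e) := by rw [hr]; ring
      _ = _ := by
        rw [radiusScale, Real.div_rpow hlog.le hρ0.le, neg_sub, Real.rpow_sub hρ0]
        ring
  have hne : Nonempty (Fin (n + 1) → Fin k) := ⟨fun _ => ⟨0, hk⟩⟩
  have hmem : ∀ j : Fin (n + 1) → Fin k, ∀ i, gridPoint a (η / k) j i ∈ Icc (a i) (a i + η) :=
    fun j => gridPoint_mem_box hk a hη.le j
  have hδ : 0 < η / k := by positivity
  refine ((hmodel ρ hρ0).measure_coverageRadius_lt_le hρ0.le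
    (fun j : Fin (n + 1) → Fin k => gridPoint a (η / k) j) (fun j => (hbox _ (hmem j)).1)
    (U := M * r ^ n) (V := C * (r ^ n * (r / (η / k)) ^ n)) (by positivity) (by positivity)
    (fun j => (hbox _ (hmem j)).2.2 r hr0.le hr1) (fun i j hij => ?_)).trans
    (ENNReal.ofReal_le_ofReal ?_)
  · have hd := le_norm_gridPoint_sub a hδ.le hij
    refine (hpair _ (hbox _ (hmem i)).1 (hbox _ (hmem i)).2.1 _ r hr0.le hr2.le
      (hδ.trans_le hd) (hrk.trans hd)).trans (ENNReal.ofReal_le_ofReal ?_)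
    gcongr
  · refine add_le_add ?_ (sub_le_sub_right (Real.exp_le_exp.2 ?_) _)
    · have h2 : ρ * (M * r ^ n) = M * b ^ n * Real.log ρ := by
        rw [hr, mul_pow, hpow]
        field_simp
      rw [h2, exp_neg_mul_log hρ0]
      have hcard : ((Fintype.card (Fin (n + 1) → Fin k) : ℕ) : ℝ) = (k : ℝ) ^ (n + 1) := by simp
      rw [hcard]
      calc ((k : ℝ) ^ (n + 1) * ρ ^ (-(M * b ^ n)))⁻¹
          ≤ ((ρ ^ e / 2) ^ (n + 1) * ρ ^ (-(M * b ^ n)))⁻¹ := by gcongr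
        _ = 2 ^ (n + 1) * (ρ ^ (e * ((n : ℝ) + 1)) * ρ ^ (-(M * b ^ n)))⁻¹ := by
            rw [div_pow, ← Real.rpow_natCast (ρ ^ e), ← Real.rpow_mul hρ0.le]
            push_cast
            rw [mul_inv, mul_inv, inv_div]
            ring
        _ = _ := by
            rw [← Real.rpow_add hρ0, ← sub_eq_add_neg, Real.rpow_neg hρ0.le]
    · calc ρ * (C * (r ^ n * (r / (η / k)) ^ n))
          = D * (Real.log ρ * (Real.log ρ / ρ) * (k : ℝ) ^ n) := by
            have : r / (η / k) = b / η * radiusScale n ρ * k := by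
              rw [hr]
              field_simp
            rw [this, hr, mul_pow b, mul_pow (b / η * radiusScale n ρ), mul_pow (b / η), hpow, hD]
            field_simp
        _ ≤ D * (Real.log ρ * (Real.log ρ / ρ) * (ρ ^ e) ^ n) := by gcongr
        _ = _ := by
            rw [← Real.rpow_natCast (ρ ^ e), ← Real.rpow_mul hρ0.le, neg_sub,
              Real.rpow_sub hρ0, Real.rpow_one, Real.rpow_two]
            ring

/-! ### The constant -/

lemma cStar_eq_ofReal {n : ℕ} (hn : 1 ≤ n) :
    cStar n = ENNReal.ofReal (((n : ℝ) + 1) / n / (capConst n * (phiInf n).toReal)) := by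
  have hn0 : (0 : ℝ) < n := by exact_mod_cast hn
  have h1 := kappa_toReal_pos n
  have h2 := kappa_toReal_pos (n + 1)
  have h3 : 0 < (phiInf n).toReal := ENNReal.toReal_pos (phiInf_pos n).ne' (phiInf_lt_top n).ne
  have e1 : ((n : ℝ≥0∞) + 1) ^ 2 / n = ENNReal.ofReal (((n : ℝ) + 1) ^ 2 / n) := by
    rw [ENNReal.ofReal_div_of_pos hn0, ENNReal.ofReal_pow (by positivity),
      ENNReal.ofReal_add hn0.le zero_le_one, ENNReal.ofReal_natCast, ENNReal.ofReal_one]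
  have e2 : kappa (n + 1) / (2 * kappa n) =
      ENNReal.ofReal ((kappa (n + 1)).toReal / (2 * (kappa n).toReal)) := by
    rw [ENNReal.ofReal_div_of_pos (by positivity), ENNReal.ofReal_mul (by positivity),
      ENNReal.ofReal_toReal (kappa_lt_top _).ne, ENNReal.ofReal_toReal (kappa_lt_top _).ne,
      ENNReal.ofReal_ofNat]
  have e3 : 1 / phiInf n = ENNReal.ofReal (1 / (phiInf n).toReal) := by
    rw [ENNReal.ofReal_div_of_pos h3, ENNReal.ofReal_one,
      ENNReal.ofReal_toReal (phiInf_lt_top n).ne]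
  rw [show cStar n = ((n : ℝ≥0∞) + 1) ^ 2 / n * (kappa (n + 1) / (2 * kappa n)) *
    (1 / phiInf n) from rfl, e1, e2, e3, ← ENNReal.ofReal_mul (by positivity),
    ← ENNReal.ofReal_mul (by positivity)]
  congr 1
  unfold capConst
  field_simp

lemma edist_ofReal_lt {x g ε : ℝ} (hx : 0 ≤ x) (hg : 0 ≤ g) (h : |x - g| < ε) :
    edist (ENNReal.ofReal x) (ENNReal.ofReal g) < ENNReal.ofReal ε := by
  change edist x.toNNReal g.toNNReal < ENNReal.ofReal ε
  rw [edist_nndist, ← ENNReal.ofReal_coe_nnreal, coe_nndist, NNReal.dist_eq,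
    Real.coe_toNNReal _ hx, Real.coe_toNNReal _ hg]
  exact (ENNReal.ofReal_lt_ofReal_iff ((abs_nonneg _).trans_lt h)).2 h

end CylinderModel

theorem theorem1 {Ω : Type*} [MeasurableSpace Ω] (P : Measure Ω) [IsProbabilityMeasure P]
    (n : ℕ) (hn : 1 ≤ n)
    (Y : ℝ → ℕ → Ω → EuclideanSpace ℝ (Fin n))
    (S : ℝ → ℕ → Ω → CylinderModel.Sphere (n + 1))
    (hmodel : ∀ ρ : ℝ, 0 < ρ → CylinderModel.IsLineModel ρ (Y ρ) (S ρ) P) :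
    TendstoInMeasure P
      (fun (ρ : ℝ) (ω : Ω) =>
        CylinderModel.coverageRadius (fun i => Y ρ i ω) (fun i => S ρ i ω)
            (Metric.closedBall (0 : EuclideanSpace ℝ (Fin (n + 1))) 1) /
          ENNReal.ofReal ((Real.log ρ / ρ) ^ (1 / (n : ℝ))))
      atTop
      (fun _ => CylinderModel.cStar n ^ (1 / (n : ℝ))) := by
  open CylinderModel in
  have hn0 : (0 : ℝ) < n := by exact_mod_cast hn
  have hΦ : 0 < (phiInf n).toReal := ENNReal.toReal_pos (phiInf_pos n).ne' (phiInf_lt_top n).ne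
  have hK : 0 < capConst n * (phiInf n).toReal := mul_pos (capConst_pos n) hΦ
  set c : ℝ := ((n : ℝ) + 1) / n / (capConst n * (phiInf n).toReal) with hc
  have hc0 : 0 < c := by positivity
  set γ : ℝ := c ^ (1 / (n : ℝ)) with hγ
  have hγ0 : 0 < γ := by positivity
  have hγn : capConst n * (phiInf n).toReal * γ ^ n = ((n : ℝ) + 1) / n := by
    rw [hγ, one_div, Real.rpow_inv_natCast_pow hc0.le (by omega), hc, mul_div_cancel₀ _ hK.ne']
  have hstar : cStar n ^ (1 / (n : ℝ)) = ENNReal.ofReal γ := by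
    rw [cStar_eq_ofReal hn, ENNReal.ofReal_rpow_of_pos hc0]
  refine tendstoInMeasure_of_ne_top fun ε hε hεtop => ?_
  set δ := ε.toReal with hδ
  have hδ0 : 0 < δ := ENNReal.toReal_pos hε.ne' hεtop
  -- The upper tail loses t twice, once to exceed the critical γ strictly and once for the grid
  -- mesh, for a deviation of at most 2t < δ. The bound γ / 2 keeps γ - t positive.
  set t := min (δ / 4) (γ / 2) with ht
  have ht0 : 0 < t := by positivity
  have ht1 : t ≤ δ / 4 := min_le_left _ _
  have ht2 : t ≤ γ / 2 := min_le_right _ _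
  have hup := tendsto_measure_lt_coverageRadius hn hmodel (b := γ + t) (t := t) (by positivity) ht0
    (by
      rw [← hγn]
      have : γ ^ n < (γ + t) ^ n := pow_lt_pow_left₀ (by linarith) hγ0.le (by omega)
      gcongr)
  have hlow := tendsto_measure_coverageRadius_lt hn hmodel (b := γ - t) (by linarith)
    (by
      rw [← hγn]
      have : (γ - t) ^ n < γ ^ n := pow_lt_pow_left₀ (by linarith) (by linarith) (by omega)
      gcongr)
  have hsum := hup.add hlow
  rw [add_zero] at hsum
  refine tendsto_of_tendsto_of_tendsto_of_le_of_le' tendsto_const_nhds hsum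
    (Eventually.of_forall fun _ => zero_le) ?_
  filter_upwards [eventually_gt_atTop 1] with ρ hρ
  refine (measure_mono ?_).trans (measure_union_le _ _)
  intro ω hω
  by_contra hcon
  simp only [mem_union, mem_ofPred_eq, not_or, not_lt] at hcon
  obtain ⟨h1, h2⟩ := hcon
  refine absurd hω ?_
  simp only [mem_ofPred_eq, not_le]
  have ha := radiusScale_pos (n := n) hρ
  set R := coverageRadius (fun i => Y ρ i ω) (fun i => S ρ i ω)
    (Metric.closedBall (0 : EuclideanSpace ℝ (Fin (n + 1))) 1)
  have hR : R ≠ ∞ := (h1.trans_lt ENNReal.ofReal_lt_top).ne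
  have h1' : R.toReal ≤ (γ + t + t) * radiusScale n ρ :=
    ENNReal.toReal_le_of_le_ofReal (by positivity) h1
  have h2' : (γ - t) * radiusScale n ρ ≤ R.toReal := (ENNReal.ofReal_le_iff_le_toReal hR).1 h2
  change edist (R / ENNReal.ofReal (radiusScale n ρ)) _ < _
  rw [hstar, ← ENNReal.ofReal_toReal hR, ← ENNReal.ofReal_toReal hεtop,
    ← ENNReal.ofReal_div_of_pos ha]
  refine edist_ofReal_lt (div_nonneg ENNReal.toReal_nonneg ha.le) hγ0.le ?_
  have h3 : R.toReal / radiusScale n ρ ≤ γ + t + t := (div_le_iff₀ ha).2 h1'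
  have h4 : γ - t ≤ R.toReal / radiusScale n ρ := (le_div_iff₀ ha).2 h2'
  exact abs_lt.2 ⟨by linarith, by linarith⟩
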